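/- **Setting.** Let $X$ be a locally compact Hausdorff space that is metrizable and countable at infinity (a countable union of compact sets). For a topological space $Y$, $\Psi(Y)$ denotes the set of lower semicontinuous functions $Y\to(-\infty,\infty]$ that are nonnegative unless $Y$ is compact. $\mathfrak M^+(X)$ is the set of positive Radon measures on $X$ with the vague topology (pointwise convergence on continuous functions with compact support), and $\mathfrak M^+(Q)$ is the set of $\nu\in\mathfrak M^+(X)$ carried by $Q\subset X$. Write $\kappa(\mu,\nu)=\int\kappa\,d(\mu\otimes\nu)$. Let $\kappa\in\Psi(X\times X)$ be a symmetric, positive definite kernel, i.e. for every signed Radon measure $\nu=\nu^+-\nu^-$ (Jordan decomposition) such that $\kappa(\nu^+,\nu^+)+\kappa(\nu^-,\nu^-)$ or $\kappa(\nu^+,\nu^-)$ is finite, one has $\kappa(\nu^+,\nu^+)+\kappa(\nu^-,\nu^-)-2\kappa(\nu^+,\nu^-)\ge0$. The inner capacity is $c_\kappa(Q)=\bigl[\inf\kappa(\nu,\nu)\bigr]^{-1}$, the infimum over $\nu\in\mathfrak M^+(Q)$ with $\nu(Q)=1$ and $\kappa(\nu,\nu)<\infty$ ($\inf\varnothing=\infty$,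 $1/\infty=0$, $1/0=\infty$). Let $I=I^+\sqcup I^-$ be a countable index set, $s_i=\pm1$ for $i\in I^\pm$, and let $\mathbf A=(A_i)_{i\in I}$ be a generalized condenser: the $A_i\subset X$ are nonempty Borel sets, every compact subset of $X$ meets only finitely many $A_i$, and $A_i\cap A_j=\varnothing$ for $i\in I^+$, $j\in I^-$. Let $f_i:X\to[-\infty,\infty]$, $a_i>0$, and let $g_i:X\to(0,\infty)$ be continuous ($i\in I$). Fix $I_0\subset I$ and, for $i\in I_0$, a constraint $\xi^i\in\mathfrak M^+(A_i)$ with $\int g_i\,d\xi^i>a_i$ (possibly $=\infty$). The admissible class $\mathcal E$ consists of all $\boldsymbol\mu=(\mu^i)_{i\in I}$ with $\mu^i\in\mathfrak M^+(A_i)$ such that $\kappa$ is $\mu^i\otimes\mu^j$-integrable for all $i,j$ and $\sum_{i,j}|\kappa(\mu^i,\mu^j)|<\infty$; $f_i$ is $\mu^i$-integrable for all $i$ and $\sum_i|\int f_i\,d\mu^i|<\infty$; $\int g_i\,d\mu^i=a_i$ for all $i$; and $\mu^i\le\xi^i$ for all $i\in I_0$. On $\mathcal E$ put $$G(\boldsymbol\mu)=\sum_{i,j\in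 I}s_is_j\kappa(\mu^i,\mu^j)+2\sum_{i\in I}\int f_i\,d\mu^i .$$ Assume $\mathcal E\neq\varnothing$. Let $\mathfrak S$ be the set of $\boldsymbol\lambda\in\mathcal E$ with $G(\boldsymbol\lambda)=\inf_{\mathcal E}G$. A net in $\mathcal E$ (indexed by a nonempty upper directed set) is minimizing if $G$ tends to $\inf_{\mathcal E}G$ along it. **Theorem.** Assume that * $\kappa$ is finite and continuous on $\{(x,y):x\ne y\}$, and $\kappa(\cdot,y)\to0$ uniformly on compact subsets of $X$ as $y$ tends to the Alexandroff point $\infty_X$ (consistency of $\kappa$ is not required); * $I^+$ or $I^-$ is finite; * each $A_i$ is nearly compact, i.e. there is a compact set $\breve A_i\subset X$ with $c_\kappa\bigl((A_i\setminus\breve A_i)\cup(\breve A_i\setminus A_i)\bigr)=0$, and these sets satisfy $\bigl(\bigcup_{i\in I^+}\breve A_i\bigr)\cap\bigl(\bigcup_{i\in I^-}\breve A_i\bigr)=\varnothing$; * $f_i\in\Psi(X)$ for every $i\in I$; * $\sum_{i\in I}a_i/g_{i,\inf}<\infty$, where $g_{i,\inf}=\inf_{A_i}g_i$ (with $a_i/0=\infty$).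 Then, for any $I_0$ and any constraints $\xi^i$ as above, $\mathfrak S$ is nonempty, compact in the vague product topology on $\mathfrak M^+(X)^{I}$, and equal to the union, over all minimizing nets, of their sets of vague cluster points in $\mathfrak M^+(X)^{I}$. -/

import Mathlib

open MeasureTheory Filter Topology
open scoped ENNReal CompactlySupported

universe u v w

noncomputable section

namespace WeightedEnergy

section Scalar

variable {X : Type u} [TopologicalSpace X] [MeasurableSpace X]

/-- Positive Radon measures on `X`, possibly of infinite total mass. -/
def RadonMeasure (X : Type u) [TopologicalSpace X] [MeasurableSpace X] : Type u :=
  {μ : Measure X // μ.Regular}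

/-- The underlying Borel measure. -/
def RadonMeasure.toMeasure (μ : RadonMeasure X) : Measure X := μ.1

/-- The vague topology: pointwise convergence on continuous functions with compact support. -/
instance : TopologicalSpace (RadonMeasure X) :=
  TopologicalSpace.induced (fun (μ : RadonMeasure X) (φ : C_c(X, ℝ)) => ∫ x, φ x ∂μ.toMeasure)
    inferInstance

/-- The class `Ψ(Y)`: lower semicontinuous functions `Y → (-∞, ∞]`, nonnegative unless `Y` is
compact. -/
structure IsPsi {Y : Type u} [TopologicalSpace Y] (ψ : Y → EReal) : Prop where
  lsc : LowerSemicontinuous ψ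
  ne_bot : ∀ y, ψ y ≠ ⊥
  nonneg : ¬ CompactSpace Y → ∀ y, 0 ≤ ψ y

/-- `∫ ψ dμ` for an extended real valued `ψ`, as the integral of the positive part minus
that of the negative part. -/
def eintegral {Y : Type u} [MeasurableSpace Y] (ψ : Y → EReal) (μ : Measure Y) : EReal :=
  ((∫⁻ y, (ψ y).toENNReal ∂μ : ℝ≥0∞) : EReal) - ((∫⁻ y, (-ψ y).toENNReal ∂μ : ℝ≥0∞) : EReal)

/-- `ψ` is `μ`-integrable: measurable up to a null set, with finite integrals of both the positive
and the negative part. -/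
structure EIntegrable {Y : Type u} [MeasurableSpace Y] (ψ : Y → EReal) (μ : Measure Y) : Prop where
  aemeasurable : AEMeasurable ψ μ
  pos_lt_top : ∫⁻ y, (ψ y).toENNReal ∂μ < ⊤
  neg_lt_top : ∫⁻ y, (-ψ y).toENNReal ∂μ < ⊤

/-- The mutual energy `κ(μ, ν) = ∫ κ d(μ ⊗ ν)` of positive measures. -/
def mutualEnergy (κ : X × X → EReal) (μ ν : RadonMeasure X) : EReal :=
  eintegral κ (μ.toMeasure.prod ν.toMeasure)

/-- `κ(μ, ν)` is finite. -/
def FiniteMutualEnergy (κ : X × X → EReal) (μ ν : RadonMeasure X) : Prop :=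
  EIntegrable κ (μ.toMeasure.prod ν.toMeasure)

/-- A kernel on `X`: a symmetric function of class `Ψ(X × X)`. -/
structure IsKernel (κ : X × X → EReal) : Prop where
  psi : IsPsi κ
  symm : ∀ x y, κ (x, y) = κ (y, x)

/-- Positive definiteness: the energy of every signed Radon measure `μ - ν` (with `μ`, `ν` its
mutually singular positive and negative parts) is nonnegative whenever it is defined, i.e.
whenever `κ(μ, μ) + κ(ν, ν)` or `κ(μ, ν)` is finite. -/
def IsPositiveDefinite (κ : X × X → EReal) : Prop :=
  ∀ μ ν : RadonMeasure X, μ.toMeasure.MutuallySingular ν.toMeasure →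
    ((FiniteMutualEnergy κ μ μ ∧ FiniteMutualEnergy κ ν ν) ∨ FiniteMutualEnergy κ μ ν) →
    0 ≤ (mutualEnergy κ μ μ + mutualEnergy κ ν ν) - 2 * mutualEnergy κ μ ν

/-- `κ` is (finite and) continuous off the diagonal. -/
def IsContinuousOffDiag (κ : X × X → EReal) : Prop :=
  ContinuousOn κ {p | p.1 ≠ p.2} ∧ ∀ x y, x ≠ y → κ (x, y) ≠ ⊤ ∧ κ (x, y) ≠ ⊥

/-- The property `(∞_X)`: `κ(·, y) → 0` as `y` tends to the point at infinity, uniformly on compact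
sets. -/
def VanishesAtInfinity (κ : X × X → EReal) : Prop :=
  ∀ K : Set X, IsCompact K → ∀ ε : ℝ, 0 < ε →
    ∀ᶠ y in cocompact X, ∀ x ∈ K, -(ε : EReal) < κ (x, y) ∧ κ (x, y) < (ε : EReal)

/-- `ν` is carried by `Q` (for `X` countable at infinity). -/
def CarriedBy (ν : RadonMeasure X) (Q : Set X) : Prop := ν.toMeasure Qᶜ = 0

/-- The inner capacity `c_κ(Q)`, with `1 / 0 = ∞` and `1 / ∞ = 0`. -/
def capacity (κ : X × X → EReal) (Q : Set X) : ℝ≥0∞ :=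
  (⨅ ν ∈ {ν : RadonMeasure X | CarriedBy ν Q ∧ FiniteMutualEnergy κ ν ν ∧ ν.toMeasure Q = 1},
    (mutualEnergy κ ν ν).toENNReal)⁻¹

/-- `Q` is nearly compact, and `Q'` is a compact set witnessing this. -/
structure IsNearlyCompactVia (κ : X × X → EReal) (Q Q' : Set X) : Prop where
  isCompact : IsCompact Q'
  capacity_symmDiff : capacity κ (symmDiff Q Q') = 0

end Scalar

/-- A generalized condenser with plates indexed by `ι`; `pos` is the set `I⁺` of indices of the
positive plates, its complement is `I⁻`. -/
structure Condenser (X : Type u) [TopologicalSpace X] [MeasurableSpace X] (ι : Type v) where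
  plate : ι → Set X
  pos : Set ι
  measurableSet_plate : ∀ i, MeasurableSet (plate i)
  nonempty_plate : ∀ i, (plate i).Nonempty
  locallyFinite : ∀ K : Set X, IsCompact K → {i | (plate i ∩ K).Nonempty}.Finite
  disjoint : ∀ i ∈ pos, ∀ j ∉ pos, Disjoint (plate i) (plate j)

section Vector

variable {X : Type u} [TopologicalSpace X] [MeasurableSpace X] {ι : Type v}

open Classical in
/-- The sign `s_i` of the plate `A_i`. -/
def Condenser.sign (A : Condenser X ι) (i : ι) : ℝ := if i ∈ A.pos then 1 else -1

/-- Positive vector measures on `X`; as a product this carries the vague product topology. -/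
abbrev VectorMeasures (X : Type u) [TopologicalSpace X] [MeasurableSpace X] (ι : Type v) :
    Type (max u v) := ι → RadonMeasure X

/-- Vector measures associated with `A` and of finite energy: every `κ` is `μⁱ ⊗ μʲ`-integrable,
and the series of the mutual energies converges absolutely. -/
structure HasFiniteEnergy (κ : X × X → EReal) (A : Condenser X ι) (μ : VectorMeasures X ι) :
    Prop where
  carried : ∀ i, CarriedBy (μ i) (A.plate i)
  finite : ∀ i j, FiniteMutualEnergy κ (μ i) (μ j)
  summable : Summable fun p : ι × ι => |(mutualEnergy κ (μ p.1) (μ p.2)).toReal|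

/-- The energy `κ(μ, μ) = ∑ s_i s_j κ(μⁱ, μʲ)` of a vector measure of finite energy. -/
def energy (κ : X × X → EReal) (A : Condenser X ι) (μ : VectorMeasures X ι) : ℝ :=
  ∑' p : ι × ι, A.sign p.1 * A.sign p.2 * (mutualEnergy κ (μ p.1) (μ p.2)).toReal

/-- `⟨f, μ⟩` is finite: each `f_i` is `μⁱ`-integrable, and the series of the integrals converges
absolutely. -/
structure HasFiniteFieldEnergy (f : ι → X → EReal) (μ : VectorMeasures X ι) : Prop where
  integrable : ∀ i, EIntegrable (f i) (μ i).toMeasure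
  summable : Summable fun i => |(eintegral (f i) (μ i).toMeasure).toReal|

/-- The weighted energy `κ(μ, μ) + 2 ⟨f, μ⟩`. -/
def weightedEnergy (κ : X × X → EReal) (A : Condenser X ι) (f : ι → X → EReal)
    (μ : VectorMeasures X ι) : ℝ :=
  energy κ A μ + 2 * ∑' i, (eintegral (f i) (μ i).toMeasure).toReal

/-- `⟨g, ν⟩ = ∫ g dν ∈ [0, ∞]` for a positive function `g`. -/
def pairing (g : X → ℝ) (ν : RadonMeasure X) : ℝ≥0∞ := ∫⁻ x, ENNReal.ofReal (g x) ∂ν.toMeasure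

/-- `ξ` is an upper constraint on the plate `Q` for the data `a`, `g`; `⟨g, ξ⟩` may be infinite. -/
structure IsConstraint (Q : Set X) (a : ℝ) (g : X → ℝ) (ξ : RadonMeasure X) : Prop where
  carried : CarriedBy ξ Q
  lt_pairing : ENNReal.ofReal a < pairing g ξ

/-- The class of admissible vector measures; the constraint `ξ i` is active only for `i ∈ I₀`. -/
def admissible (κ : X × X → EReal) (A : Condenser X ι) (f : ι → X → EReal) (a : ι → ℝ)
    (g : ι → X → ℝ) (I₀ : Set ι) (ξ : ι → RadonMeasure X) : Set (VectorMeasures X ι) :=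
  {μ | HasFiniteEnergy κ A μ ∧ HasFiniteFieldEnergy f μ ∧
    (∀ i, pairing (g i) (μ i) = ENNReal.ofReal (a i)) ∧
    ∀ i ∈ I₀, (μ i).toMeasure ≤ (ξ i).toMeasure}

/-- The infimum of the weighted energy over the admissible class. -/
def minimalValue (κ : X × X → EReal) (A : Condenser X ι) (f : ι → X → EReal) (a : ι → ℝ)
    (g : ι → X → ℝ) (I₀ : Set ι) (ξ : ι → RadonMeasure X) : EReal :=
  ⨅ μ ∈ admissible κ A f a g I₀ ξ, (weightedEnergy κ A f μ : EReal)

/-- The solutions of the minimum energy problem. -/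
def solutions (κ : X × X → EReal) (A : Condenser X ι) (f : ι → X → EReal) (a : ι → ℝ)
    (g : ι → X → ℝ) (I₀ : Set ι) (ξ : ι → RadonMeasure X) : Set (VectorMeasures X ι) :=
  {μ | μ ∈ admissible κ A f a g I₀ ξ ∧
    (weightedEnergy κ A f μ : EReal) = minimalValue κ A f a g I₀ ξ}

/-- A net of admissible measures whose weighted energies tend to the infimum. -/
structure IsMinimizingNet (κ : X × X → EReal) (A : Condenser X ι) (f : ι → X → EReal) (a : ι → ℝ)
    (g : ι → X → ℝ) (I₀ : Set ι) (ξ : ι → RadonMeasure X) {S : Type w} [Preorder S]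
    (μ : S → VectorMeasures X ι) : Prop where
  mem : ∀ s, μ s ∈ admissible κ A f a g I₀ ξ
  tendsto : Tendsto (fun s => (weightedEnergy κ A f (μ s) : EReal)) atTop
    (𝓝 (minimalValue κ A f a g I₀ ξ))

/-- The set of vague cluster points of a net. -/
def clusterSet {S : Type w} [Preorder S] (μ : S → VectorMeasures X ι) :
    Set (VectorMeasures X ι) :=
  {l | MapClusterPt l atTop μ}

/-- The union of the vague cluster sets of all minimizing nets, indexed by nonempty upper directed
sets in the universe `w`. -/
def minimizingClusterPoints (κ : X × X → EReal) (A : Condenser X ι) (f : ι → X → EReal)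
    (a : ι → ℝ) (g : ι → X → ℝ) (I₀ : Set ι) (ξ : ι → RadonMeasure X) :
    Set (VectorMeasures X ι) :=
  {l | ∃ (S : Type w) (_ : Preorder S) (_ : IsDirectedOrder S) (_ : Nonempty S)
    (μ : S → VectorMeasures X ι), IsMinimizingNet κ A f a g I₀ ξ μ ∧ l ∈ clusterSet μ}

end Vector

end WeightedEnergy

end

/-!
Every admissible vector measure `μ` has components of finite energy, which charge no set of
inner capacity zero (`measure_eq_zero_of_capacity_eq_zero`). Hence `μ i` is carried not only by the
plate `A i` but by a compact set `K i`, and its mass is at most `m i = a i / inf g i`, where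
`∑ m i < ∞`. The vector measures with these carriers and mass bounds, the normalizations
`⟨g i, μ i⟩ = a i` and the constraints form a vaguely compact class `D` (`carriedClass`), by
Prokhorov's theorem on compact sets and Tychonoff's theorem.

The compact sets can be chosen so that the kernel is bounded and continuous between carriers of
opposite signs (`exists_compact_carriers`). This uses that one of the two groups of plates is finite,
that the condenser is locally finite and that the kernel vanishes at infinity. Between carriers of
equal signs the kernel is bounded below. So there is one constant `B` for which all the signed kernels
`s i * s j * κ + B` are nonnegative and lower semicontinuous on `K i × K j`; similarly all `f i + C`
are nonnegative for one constant `C`. With `T` the total mass of all components, the weighted energy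
therefore equals

  `∑ ∫ (s i * s j * κ + B) d(μ i ⊗ μ j) + 2 * ∑ ∫ (f i + C) d(μ i) - (B * T ^ 2 + 2 * C * T)`

on the admissible class (`weightedEnergy_eq`). The sums are vaguely lower semicontinuous on `D`,
since the product of measures carried by compact sets is vaguely continuous, while `T` is continuous
there because its series is dominated by `∑ m i`. The whole expression is `∞` exactly at the points
of `D` that are not admissible (`mem_admissible_of_shiftedEnergy_lt_top`): a finite value makes all
energies finite, and then the components vanish on `K i \ A i`. The theorem is thus a statement on
the minimizers of a lower semicontinuous function on a compact set
(`minimizers_of_lowerSemicontinuousOn`), every minimizer being the limit of a constant net.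
-/

open Set
open scoped NNReal BoundedContinuousFunction

/-! ### Weak convergence of finite measures -/

namespace MeasureTheory.FiniteMeasure

/-- The product of finite measures is jointly continuous for weak convergence. Away from the zero
measure this is the statement for the normalized probability measures; at zero it suffices that
the mass of the product tends to zero. -/
theorem continuous_prod {α β : Type*} [MeasurableSpace α] [MeasurableSpace β] [TopologicalSpace α]
    [TopologicalSpace β] [SecondCountableTopology α] [SecondCountableTopology β]
    [TopologicalSpace.PseudoMetrizableSpace α] [TopologicalSpace.PseudoMetrizableSpace β]
    [OpensMeasurableSpace α] [OpensMeasurableSpace β] :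
    Continuous fun p : FiniteMeasure α × FiniteMeasure β => p.1.prod p.2 := by
  refine continuous_iff_continuousAt.2 fun p => ?_
  have hmass : Tendsto (fun q : FiniteMeasure α × FiniteMeasure β => (q.1.prod q.2).mass) (𝓝 p)
      (𝓝 (p.1.prod p.2).mass) := by
    simp only [mass_prod]
    exact (((continuous_mass.comp continuous_fst).mul
      (continuous_mass.comp continuous_snd)).tendsto p)
  by_cases h0 : p.1.prod p.2 = 0
  · rw [h0, (mass_zero_iff _).2 rfl] at hmass
    rw [ContinuousAt, h0]
    exact tendsto_zero_of_tendsto_zero_mass hmass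
  have hne : p.1 ≠ 0 ∧ p.2 ≠ 0 := by
    constructor <;> intro h <;> simp [h] at h0
  obtain ⟨⟨a0⟩, ⟨b0⟩⟩ : Nonempty α ∧ Nonempty β := by
    constructor <;> by_contra h <;> rw [not_nonempty_iff] at h
    · exact hne.1 (Subtype.ext (Measure.eq_zero_of_isEmpty _))
    · exact hne.2 (Subtype.ext (Measure.eq_zero_of_isEmpty _))
  have : Nonempty α := ⟨a0⟩
  have : Nonempty β := ⟨b0⟩
  have hformula : ∀ q : FiniteMeasure α × FiniteMeasure β,
      q.1.prod q.2 = (q.1.mass * q.2.mass) • (q.1.normalize.prod q.2.normalize).toFiniteMeasure := by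
    intro q
    apply Subtype.ext
    have h1 : (q.1 : Measure α) = (q.1.mass : ℝ≥0∞) • (q.1.normalize : Measure α) := by
      conv_lhs => rw [q.1.self_eq_mass_smul_normalize]
      rfl
    have h2 : (q.2 : Measure β) = (q.2.mass : ℝ≥0∞) • (q.2.normalize : Measure β) := by
      conv_lhs => rw [q.2.self_eq_mass_smul_normalize]
      rfl
    change (q.1 : Measure α).prod (q.2 : Measure β) =
      ((q.1.mass * q.2.mass : ℝ≥0) : ℝ≥0∞) • (q.1.normalize : Measure α).prod
        (q.2.normalize : Measure β)
    conv_lhs => rw [h1, h2]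
    rw [Measure.prod_smul_left, Measure.prod_smul_right, smul_smul, ENNReal.coe_mul]
  have hn : Tendsto (fun q : FiniteMeasure α × FiniteMeasure β =>
      (q.1.normalize.prod q.2.normalize).toFiniteMeasure) (𝓝 p)
      (𝓝 (p.1.normalize.prod p.2.normalize).toFiniteMeasure) := by
    have h1 := tendsto_normalize_of_tendsto (μ := p.1) (continuous_fst.tendsto p) hne.1
    have h2 := tendsto_normalize_of_tendsto (μ := p.2) (continuous_snd.tendsto p) hne.2
    exact ((ProbabilityMeasure.toFiniteMeasure_continuous.comp
      ProbabilityMeasure.continuous_prod).tendsto (p.1.normalize, p.2.normalize)).comp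
        (h1.prodMk_nhds h2)
  rw [ContinuousAt, hformula p, funext hformula]
  have hm : Tendsto (fun q : FiniteMeasure α × FiniteMeasure β => q.1.mass * q.2.mass) (𝓝 p)
      (𝓝 (p.1.mass * p.2.mass)) := by simpa only [mass_prod] using hmass
  exact hm.smul hn

variable {Y : Type*} [TopologicalSpace Y] [TopologicalSpace.PseudoMetrizableSpace Y]
  [SecondCountableTopology Y] [MeasurableSpace Y] [OpensMeasurableSpace Y]

/-- A lower semicontinuous function `Y → [0, ∞]` is the supremum of an increasing sequence of
bounded continuous functions. -/
theorem _root_.LowerSemicontinuous.exists_monotone_seq_continuous {Y : Type*} [TopologicalSpace Y]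
    [TopologicalSpace.PseudoMetrizableSpace Y] [SecondCountableTopology Y] {h : Y → ℝ≥0∞}
    (hh : LowerSemicontinuous h) :
    ∃ F : ℕ → Y → ℝ≥0∞, Monotone F ∧ (∀ n, Continuous (F n)) ∧
      (∀ n, ∃ C : ℝ≥0, ∀ y, F n y ≤ C) ∧ ∀ y, h y = ⨆ n, F n y := by
  let : PseudoMetricSpace Y := TopologicalSpace.pseudoMetrizableSpacePseudoMetric Y
  -- `h` is the supremum of all bounded continuous functions below it, by Urysohn's lemma. The
  -- Lindelöf property makes this family countable, and partial suprema make it increasing.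
  set 𝓕 : Set (Y → ℝ≥0∞) := {f | Continuous f ∧ (∃ C : ℝ≥0, ∀ y, f y ≤ C) ∧ f ≤ h}
  have hlub : IsLUB 𝓕 h := by
    refine ⟨fun f hf => hf.2.2, fun b hb y => ?_⟩
    refine le_of_forall_lt fun t ht => ?_
    obtain ⟨r, htr, hrh⟩ := exists_between ht
    have hO : IsOpen {z | r < h z} := hh.isOpen_preimage r
    obtain ⟨φ, hφ0, hφ1, hφ⟩ := exists_continuous_zero_one_of_isClosed hO.isClosed_compl
      (isClosed_closure (s := {y})) (by
        -- Points of `closure {y}` are inseparable from `y`, so every open set around `y` has them.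
        rw [Set.disjoint_compl_left_iff_subset]
        intro z hz
        have hi : Inseparable z y := by
          rw [inseparable_iff_mem_closure]
          refine ⟨hz, ?_⟩
          rw [Metric.mem_closure_iff] at hz ⊢
          intro ε hε
          obtain ⟨_, rfl, hb⟩ := hz ε hε
          exact ⟨z, rfl, by rwa [dist_comm]⟩
        exact (hi.mem_open_iff hO).2 hrh)
    have hr : r ≠ ∞ := hrh.ne_top
    refine htr.trans_le ?_
    have hmem : (fun z => r * ENNReal.ofReal (φ z)) ∈ 𝓕 := by
      refine ⟨?_, ⟨r.toNNReal, fun z => ?_⟩, fun z => ?_⟩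
      · exact ENNReal.continuous_const_mul hr |>.comp
          (ENNReal.continuous_ofReal.comp φ.continuous)
      · rw [ENNReal.coe_toNNReal hr]
        exact mul_le_of_le_one_right' (ENNReal.ofReal_le_one.2 (hφ z).2)
      · by_cases hz : r < h z
        · exact (mul_le_of_le_one_right' (ENNReal.ofReal_le_one.2 (hφ z).2)).trans hz.le
        · have : φ z = 0 := hφ0 hz
          simp [this]
    have h2 : φ y = 1 := hφ1 (subset_closure rfl)
    simpa [h2] using hb hmem y
  obtain ⟨𝓕', hsub, hcount, hlub'⟩ := exists_countable_lowerSemicontinuous_isLUB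
    (fun f hf => hf.1.lowerSemicontinuous) hlub
  have h0 : (0 : Y → ℝ≥0∞) ∈ 𝓕 := ⟨continuous_const, ⟨0, fun _ => le_rfl⟩, fun _ => zero_le⟩
  obtain ⟨f, hf⟩ := (hcount.insert (0 : Y → ℝ≥0∞)).exists_eq_range ⟨0, mem_insert _ _⟩
  have hfm : ∀ n, f n ∈ 𝓕 := fun n => by
    have : f n ∈ insert (0 : Y → ℝ≥0∞) 𝓕' := hf ▸ mem_range_self n
    rcases this with h | h
    · exact h ▸ h0
    · exact hsub h
  have hp : ∀ n, partialSups f n ∈ 𝓕 := by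
    intro n
    induction n with
    | zero => simpa using hfm 0
    | succ n ih =>
      obtain ⟨h1, ⟨C, hC⟩, h2⟩ := ih
      obtain ⟨h1', ⟨C', hC'⟩, h2'⟩ := hfm (n + 1)
      rw [partialSups_add_one]
      exact ⟨h1.sup h1', ⟨C ⊔ C', fun y => by
        simpa using sup_le_sup (hC y) (hC' y)⟩, sup_le h2 h2'⟩
  refine ⟨partialSups f, (partialSups f).monotone, fun n => (hp n).1, fun n => (hp n).2.1,
    fun y => le_antisymm ?_ (iSup_le fun n => (hp n).2.2 y)⟩
  have : h ≤ fun y => ⨆ n, partialSups f n y := by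
    refine hlub'.2 fun g hg => ?_
    obtain ⟨n, rfl⟩ : g ∈ range f := hf ▸ mem_insert_of_mem _ hg
    exact fun z => (le_partialSups f n z).trans (le_iSup (fun n => partialSups f n z) n)
  exact this y

/-- Integration of a lower semicontinuous function `Y → [0, ∞]` is lower semicontinuous for weak
convergence. -/
theorem lowerSemicontinuous_lintegral {h : Y → ℝ≥0∞} (hh : LowerSemicontinuous h) :
    LowerSemicontinuous fun μ : FiniteMeasure Y => ∫⁻ y, h y ∂(μ : Measure Y) := by
  obtain ⟨F, hmono, hcont, hbdd, hsup⟩ := hh.exists_monotone_seq_continuous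
  have : ∀ μ : FiniteMeasure Y, ∫⁻ y, h y ∂(μ : Measure Y) = ⨆ n, ∫⁻ y, F n y ∂(μ : Measure Y) := by
    intro μ
    simp only [hsup]
    exact lintegral_iSup (fun n => (hcont n).measurable) hmono
  simp only [this]
  refine lowerSemicontinuous_iSup fun n => Continuous.lowerSemicontinuous ?_
  obtain ⟨C, hC⟩ := hbdd n
  have hne : ∀ y, F n y ≠ ∞ := fun y => ((hC y).trans_lt ENNReal.coe_lt_top).ne
  let φ : Y →ᵇ ℝ≥0 := BoundedContinuousFunction.mkOfBound
    ⟨fun y => (F n y).toNNReal, ENNReal.continuousOn_toNNReal.comp_continuous (hcont n) hne⟩ C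
    (fun x y => by
      have hle : ∀ y, ((F n y).toNNReal : ℝ) ≤ C := fun y =>
        NNReal.coe_le_coe.2 (by simpa using ENNReal.toNNReal_mono ENNReal.coe_ne_top (hC y))
      rw [ContinuousMap.coe_mk, NNReal.dist_eq, abs_sub_le_iff]
      have hx := hle x
      have hy := hle y
      have hx0 := ((F n x).toNNReal).coe_nonneg
      have hy0 := ((F n y).toNNReal).coe_nonneg
      constructor <;> linarith)
  have hφ : ∀ μ : FiniteMeasure Y, ∫⁻ y, F n y ∂(μ : Measure Y) = ∫⁻ y, φ y ∂(μ : Measure Y) := by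
    intro μ
    refine lintegral_congr fun y => ?_
    exact (ENNReal.coe_toNNReal (hne y)).symm
  simp only [hφ]
  refine continuous_iff_continuousAt.2 fun μ => ?_
  exact tendsto_iff_forall_lintegral_tendsto.1 tendsto_id φ

end MeasureTheory.FiniteMeasure

/-! ### The vague topology on Radon measures carried by a compact set -/

namespace WeightedEnergy.RadonMeasure

variable {X : Type u} [TopologicalSpace X] [MeasurableSpace X]

instance (μ : RadonMeasure X) : μ.toMeasure.Regular := μ.2

theorem continuous_integral (φ : C_c(X, ℝ)) :
    Continuous fun μ : RadonMeasure X => ∫ x, φ x ∂μ.toMeasure :=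
  (continuous_apply φ).comp (continuous_induced_dom
    (f := fun (μ : RadonMeasure X) (φ : C_c(X, ℝ)) => ∫ x, φ x ∂μ.toMeasure))

theorem restrict_eq_self {K : Set X} {μ : RadonMeasure X} (h : μ.toMeasure Kᶜ = 0) :
    μ.toMeasure.restrict K = μ.toMeasure :=
  Measure.restrict_eq_self_of_ae_mem h

/-- The restriction of a Radon measure to a compact set, as a finite measure. -/
noncomputable def restrictCompact {K : Set X} (hK : IsCompact K) (μ : RadonMeasure X) :
    FiniteMeasure X :=
  ⟨μ.toMeasure.restrict K, ⟨by
    rw [Measure.restrict_apply_univ]; exact hK.measure_lt_top⟩⟩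

theorem isFiniteMeasure {K : Set X} (hK : IsCompact K) {μ : RadonMeasure X}
    (h : μ.toMeasure Kᶜ = 0) : IsFiniteMeasure μ.toMeasure :=
  restrict_eq_self h ▸ (restrictCompact hK μ).2

variable [LocallyCompactSpace X] [TopologicalSpace.MetrizableSpace X] [BorelSpace X]

instance : T2Space (RadonMeasure X) := by
  refine T2Space.of_injective_continuous (f := fun (μ : RadonMeasure X) (φ : C_c(X, ℝ)) =>
    ∫ x, φ x ∂μ.toMeasure) (fun μ ν h => Subtype.ext ?_) continuous_induced_dom
  have hμ : Measure.Regular μ.1 := μ.2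
  have hν : Measure.Regular ν.1 := ν.2
  exact Measure.ext_of_integral_eq_on_compactlySupported fun φ => congrFun h φ

/-- Integration of a fixed nonnegative continuous function, not necessarily of compact support, is
vaguely continuous on the measures carried by a fixed compact set. -/
theorem continuousOn_lintegral {K : Set X} (hK : IsCompact K) {g : X → ℝ≥0} (hg : Continuous g) :
    ContinuousOn (fun μ : RadonMeasure X => ∫⁻ x, g x ∂μ.toMeasure)
      {μ | μ.toMeasure Kᶜ = 0} := by
  obtain ⟨χ, hχ1, hχc, -, hχ⟩ := exists_continuousMap_one_of_isCompact_subset_isOpen hK isOpen_univ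
    (subset_univ K)
  let φ : C_c(X, ℝ) := ⟨⟨fun x => χ x * g x, by fun_prop⟩, HasCompactSupport.mul_right hχc⟩
  have hφ0 : ∀ x, 0 ≤ φ x := fun x => mul_nonneg (hχ x).1 (g x).coe_nonneg
  refine (ENNReal.continuous_ofReal.comp (continuous_integral φ)).continuousOn.congr ?_
  intro μ hμ
  have hint : Integrable φ μ.toMeasure := φ.continuous.integrable_of_hasCompactSupport φ.2
  simp only [Function.comp]
  rw [ofReal_integral_eq_lintegral_ofReal hint (Eventually.of_forall hφ0)]
  refine lintegral_congr_ae ?_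
  have : ∀ᵐ x ∂μ.toMeasure, x ∈ K := hμ
  filter_upwards [this] with x hx
  have h1 : φ x = g x := by
    change χ x * g x = g x
    rw [hχ1 hx]; simp
  rw [h1, ENNReal.ofReal_coe_nnreal]

/-- On measures carried by a compact set the vague topology is as fine as the weak one. -/
theorem continuousOn_restrictCompact {K : Set X} (hK : IsCompact K) :
    ContinuousOn (restrictCompact hK : RadonMeasure X → FiniteMeasure X)
      {μ | μ.toMeasure Kᶜ = 0} := by
  intro μ hμ
  rw [ContinuousWithinAt, FiniteMeasure.tendsto_iff_forall_lintegral_tendsto]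
  intro φ
  have h1 : ∀ ν ∈ {μ : RadonMeasure X | μ.toMeasure Kᶜ = 0},
      ∫⁻ x, φ x ∂(restrictCompact hK ν : Measure X) = ∫⁻ x, φ x ∂ν.toMeasure := by
    intro ν hν
    change ∫⁻ x, φ x ∂(ν.toMeasure.restrict K) = _
    rw [restrict_eq_self hν]
  exact ((continuousOn_lintegral hK φ.continuous).congr h1) μ hμ

variable [SecondCountableTopology X]

/-- The measures of mass at most `m` carried by a compact set form a vaguely compact set. -/
theorem isCompact_setOf_mass_le {K : Set X} (hK : IsCompact K) (m : ℝ≥0) :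
    IsCompact {μ : RadonMeasure X | μ.toMeasure Kᶜ = 0 ∧ μ.toMeasure univ ≤ m} := by
  let Φ : FiniteMeasure X → RadonMeasure X := fun μ => ⟨μ, inferInstance⟩
  have hΦ : Continuous Φ := by
    refine continuous_induced_rng.2 (continuous_pi fun φ => ?_)
    obtain ⟨C, hC⟩ := φ.2.exists_bound_of_continuous φ.1.continuous
    let ψ : X →ᵇ ℝ := BoundedContinuousFunction.ofNormedAddCommGroup φ φ.1.continuous C hC
    refine continuous_iff_continuousAt.2 fun μ => ?_
    exact FiniteMeasure.tendsto_iff_forall_integral_tendsto.1 tendsto_id ψ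
  have := (isCompact_setOfPred_finiteMeasure_le_of_isCompact m hK).image hΦ
  convert this using 1
  ext μ
  constructor
  · rintro ⟨h1, h2⟩
    have := isFiniteMeasure hK h1
    let ν : FiniteMeasure X := ⟨μ.toMeasure, this⟩
    refine ⟨ν, ⟨?_, ?_⟩, rfl⟩
    · rw [← ENNReal.coe_le_coe, FiniteMeasure.ennreal_mass]; exact h2
    · rw [FiniteMeasure.null_iff_toMeasure_null]; exact h1
  · rintro ⟨ν, ⟨h1, h2⟩, rfl⟩
    rw [FiniteMeasure.null_iff_toMeasure_null] at h2
    rw [← ENNReal.coe_le_coe, FiniteMeasure.ennreal_mass] at h1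
    exact ⟨h2, h1⟩

theorem lowerSemicontinuousOn_lintegral {K : Set X} (hK : IsCompact K) {h : X → ℝ≥0∞}
    (hh : LowerSemicontinuous h) :
    LowerSemicontinuousOn (fun μ : RadonMeasure X => ∫⁻ x, h x ∂μ.toMeasure)
      {μ | μ.toMeasure Kᶜ = 0} := by
  intro μ hμ y hy
  replace hy : y < ∫⁻ x, h x ∂(restrictCompact hK μ : Measure X) :=
    hy.trans_eq (congrArg (fun m => ∫⁻ x, h x ∂m) (restrict_eq_self hμ).symm)
  have h1 := continuousOn_restrictCompact hK μ hμ
  filter_upwards [h1 (FiniteMeasure.lowerSemicontinuous_lintegral hh _ y hy),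
    self_mem_nhdsWithin] with ν hν hνK
  rw [← restrict_eq_self hνK]
  exact hν

/-- Mutual energies with respect to a lower semicontinuous kernel `h ≥ 0` are jointly vaguely lower
semicontinuous on measures carried by fixed compact sets. -/
theorem lowerSemicontinuousOn_lintegral_prod {K L : Set X} (hK : IsCompact K) (hL : IsCompact L)
    {h : X × X → ℝ≥0∞} (hh : LowerSemicontinuous h) :
    LowerSemicontinuousOn (fun p : RadonMeasure X × RadonMeasure X =>
      ∫⁻ x, h x ∂(p.1.toMeasure.prod p.2.toMeasure))
      ({μ | μ.toMeasure Kᶜ = 0} ×ˢ {μ | μ.toMeasure Lᶜ = 0}) := by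
  intro p hp y hy
  simp only at hy
  rw [← restrict_eq_self hp.1, ← restrict_eq_self hp.2] at hy
  have h1 : ContinuousOn (fun p : RadonMeasure X × RadonMeasure X =>
      (restrictCompact hK p.1).prod (restrictCompact hL p.2))
      ({μ | μ.toMeasure Kᶜ = 0} ×ˢ {μ | μ.toMeasure Lᶜ = 0}) :=
    FiniteMeasure.continuous_prod.comp_continuousOn
      (((continuousOn_restrictCompact hK).comp continuousOn_fst fun q hq => hq.1).prodMk
        ((continuousOn_restrictCompact hL).comp continuousOn_snd fun q hq => hq.2))
  filter_upwards [h1 p hp (FiniteMeasure.lowerSemicontinuous_lintegral hh _ y hy),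
    self_mem_nhdsWithin] with q hq hqK
  rw [← restrict_eq_self hqK.1, ← restrict_eq_self hqK.2]
  exact hq

/-- A vague upper constraint is a closed condition on measures carried by a compact set. -/
theorem isClosed_setOf_le_inter {K : Set X} (hK : IsCompact K) {D : Set (RadonMeasure X)}
    (hD : IsClosed D) (hDK : D ⊆ {μ | μ.toMeasure Kᶜ = 0}) (ξ : RadonMeasure X) :
    IsClosed (D ∩ {μ | μ.toMeasure ≤ ξ.toMeasure}) := by
  have : D ∩ {μ | μ.toMeasure ≤ ξ.toMeasure} =
      D ∩ ⋂ O : {O : Set X // IsOpen O}, D ∩ {μ | μ.toMeasure O ≤ ξ.toMeasure O} := by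
    ext μ
    simp only [mem_inter_iff, mem_ofPred_eq, mem_iInter, Subtype.forall]
    refine and_congr_right fun hμ => ⟨fun h O _ => ⟨hμ, h O⟩, fun h => ?_⟩
    -- By outer regularity of `ξ` it suffices to compare the measures on open sets.
    refine Measure.le_intro fun s _ _ => ?_
    rw [s.measure_eq_iInf_isOpen ξ.toMeasure]
    refine le_iInf fun O => le_iInf fun hsO => le_iInf fun hO => ?_
    exact (measure_mono hsO).trans (h O hO).2
  rw [this]
  refine hD.inter (isClosed_iInter fun O => ?_)
  have hlsc : LowerSemicontinuous (O.1.indicator (1 : X → ℝ≥0∞)) :=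
    O.2.lowerSemicontinuous_indicator zero_le_one
  have := ((lowerSemicontinuousOn_lintegral hK hlsc).mono hDK)
  rw [lowerSemicontinuousOn_iff_preimage_Iic] at this
  obtain ⟨v, hv, hv'⟩ := this (ξ.toMeasure O)
  have h2 : D ∩ {μ : RadonMeasure X | μ.toMeasure O ≤ ξ.toMeasure O} = D ∩ v := by
    rw [← hv']
    ext μ
    simp [lintegral_indicator_one O.2.measurableSet]
  rw [h2]
  exact hD.inter hv

end WeightedEnergy.RadonMeasure

/-! ### Integrals of extended real valued functions -/

namespace WeightedEnergy

section EIntegral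

variable {Y : Type*} [MeasurableSpace Y] {ψ : Y → EReal} {π : Measure Y}

theorem EIntegrable.exists_integrable (hψ : EIntegrable ψ π) :
    ∃ r : Y → ℝ, Integrable r π ∧ ψ =ᵐ[π] fun y => (r y : EReal) := by
  have hm : AEMeasurable (fun y => (ψ y).toReal) π :=
    measurable_ereal_toReal.comp_aemeasurable hψ.aemeasurable
  have h1 : AEMeasurable (fun y => (ψ y).toENNReal) π :=
    EReal.continuous_toENNReal.measurable.comp_aemeasurable hψ.aemeasurable
  have h2 : AEMeasurable (fun y => (-ψ y).toENNReal) π :=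
    EReal.continuous_toENNReal.measurable.comp_aemeasurable hψ.aemeasurable.neg
  have hae : ∀ᵐ y ∂π, ψ y ≠ ⊤ ∧ ψ y ≠ ⊥ := by
    filter_upwards [ae_lt_top' h1 hψ.pos_lt_top.ne, ae_lt_top' h2 hψ.neg_lt_top.ne] with y hy1 hy2
    refine ⟨fun h => ?_, fun h => ?_⟩
    · simp [h] at hy1
    · simp [h] at hy2
  refine ⟨fun y => (ψ y).toReal, ⟨hm.aestronglyMeasurable, ?_⟩, ?_⟩
  · rw [hasFiniteIntegral_iff_enorm]
    calc ∫⁻ y, ‖(ψ y).toReal‖ₑ ∂π = ∫⁻ y, (ψ y).toENNReal + (-ψ y).toENNReal ∂π := by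
          refine lintegral_congr_ae ?_
          filter_upwards [hae] with y hy
          lift ψ y to ℝ using hy with t ht
          rw [← EReal.coe_neg, EReal.real_coe_toENNReal, EReal.real_coe_toENNReal,
            EReal.toReal_coe, Real.enorm_eq_ofReal_abs]
          rcases le_total 0 t with h | h
          · rw [abs_of_nonneg h, ENNReal.ofReal_of_nonpos (neg_nonpos.2 h), add_zero]
          · rw [abs_of_nonpos h, ENNReal.ofReal_of_nonpos h, zero_add]
      _ = _ := lintegral_add_left' h1 _
      _ < ∞ := ENNReal.add_lt_top.2 ⟨hψ.pos_lt_top, hψ.neg_lt_top⟩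
  · filter_upwards [hae] with y hy
    exact (EReal.coe_toReal hy.1 hy.2).symm

theorem eIntegrable_of_ae_eq {r : Y → ℝ} (hr : Integrable r π)
    (h : ψ =ᵐ[π] fun y => (r y : EReal)) :
    EIntegrable ψ π ∧ eintegral ψ π = ((∫ y, r y ∂π : ℝ) : EReal) := by
  have h1 : ∫⁻ y, (ψ y).toENNReal ∂π = ∫⁻ y, ENNReal.ofReal (r y) ∂π := by
    refine lintegral_congr_ae ?_
    filter_upwards [h] with y hy
    rw [hy, EReal.real_coe_toENNReal]
  have h2 : ∫⁻ y, (-ψ y).toENNReal ∂π = ∫⁻ y, ENNReal.ofReal (-r y) ∂π := by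
    refine lintegral_congr_ae ?_
    filter_upwards [h] with y hy
    rw [hy, ← EReal.coe_neg, EReal.real_coe_toENNReal]
  have f1 : ∫⁻ y, ENNReal.ofReal (r y) ∂π < ∞ := hr.lintegral_lt_top
  have f2 : ∫⁻ y, ENNReal.ofReal (-r y) ∂π < ∞ := hr.neg.lintegral_lt_top
  refine ⟨⟨(measurable_coe_real_ereal.comp_aemeasurable hr.aemeasurable).congr h.symm,
    h1 ▸ f1, h2 ▸ f2⟩, ?_⟩
  rw [eintegral, h1, h2, integral_eq_lintegral_pos_part_sub_lintegral_neg_part hr, EReal.coe_sub,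
    EReal.coe_ennreal_toReal f1.ne, EReal.coe_ennreal_toReal f2.ne]

variable [IsFiniteMeasure π] {h : Y → ℝ≥0∞} {σ B : ℝ}

/-- If the nonnegative function `h` represents `σ ψ + B` and `ψ` is integrable, then the Lebesgue
integral of `h` is finite and given by that of `ψ`. -/
theorem EIntegrable.lintegral_affine
    (hh : ∀ᵐ y ∂π, (h y : EReal) = (σ : EReal) * ψ y + (B : EReal)) (hψ : EIntegrable ψ π) :
    ∫⁻ y, h y ∂π < ∞ ∧
      (∫⁻ y, h y ∂π).toReal = σ * (eintegral ψ π).toReal + B * π.real univ := by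
  obtain ⟨r, hr, hψr⟩ := hψ.exists_integrable
  have hae : ∀ᵐ y ∂π, 0 ≤ σ * r y + B ∧ h y = ENNReal.ofReal (σ * r y + B) := by
    filter_upwards [hh, hψr] with y hy hy'
    rw [hy', ← EReal.coe_mul, ← EReal.coe_add] at hy
    have h0 : 0 ≤ σ * r y + B := by
      rw [← EReal.coe_nonneg, ← hy]; exact EReal.coe_ennreal_nonneg _
    refine ⟨h0, ?_⟩
    rw [← EReal.toENNReal_coe (x := h y), hy, EReal.real_coe_toENNReal]
  have hint : Integrable (fun y => σ * r y + B) π := (hr.const_mul σ).add (integrable_const B)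
  have heq : ∫⁻ y, h y ∂π = ENNReal.ofReal (∫ y, (σ * r y + B) ∂π) := by
    rw [ofReal_integral_eq_lintegral_ofReal hint (hae.mono fun y hy => hy.1)]
    exact lintegral_congr_ae (hae.mono fun y hy => hy.2)
  refine ⟨heq ▸ ENNReal.ofReal_lt_top, ?_⟩
  rw [heq, ENNReal.toReal_ofReal (integral_nonneg_of_ae (hae.mono fun y hy => hy.1)),
    integral_add (hr.const_mul σ) (integrable_const B), integral_const_mul, integral_const,
    (eIntegrable_of_ae_eq hr hψr).2, EReal.toReal_coe, smul_eq_mul, mul_comm B]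

/-- The converse, for `σ = ±1`: a finite integral of `h` makes `ψ` integrable. -/
theorem eIntegrable_of_lintegral_affine (hσ : σ = 1 ∨ σ = -1) (hm : AEMeasurable h π)
    (hh : ∀ᵐ y ∂π, (h y : EReal) = (σ : EReal) * ψ y + (B : EReal)) (hfin : ∫⁻ y, h y ∂π < ∞) :
    EIntegrable ψ π := by
  have hint : Integrable (fun y => σ * ((h y).toReal - B)) π :=
    ((integrable_toReal_of_lintegral_ne_top hm hfin.ne).sub (integrable_const B)).const_mul σ
  refine (eIntegrable_of_ae_eq hint ?_).1
  filter_upwards [hh, ae_lt_top' hm hfin.ne] with y hy hy'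
  rw [← EReal.coe_ennreal_toReal hy'.ne] at hy
  generalize (h y).toReal = t at hy ⊢
  generalize ψ y = z at hy ⊢
  rcases hσ with rfl | rfl
  · induction z with
    | bot => simp at hy
    | top => simp at hy
    | coe z =>
      norm_cast at hy
      exact congrArg _ (by linarith)
  · rw [EReal.coe_neg, neg_mul, EReal.coe_one, one_mul] at hy
    induction z with
    | bot => simp at hy
    | top => simp at hy
    | coe z =>
      norm_cast at hy
      exact congrArg _ (by linarith)

theorem IsPsi.exists_lower_bound {Y : Type*} [TopologicalSpace Y] {ψ : Y → EReal} (hψ : IsPsi ψ) :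
    ∃ c : ℝ, 0 ≤ c ∧ ∀ y, -(c : EReal) ≤ ψ y := by
  by_cases hc : CompactSpace Y
  · rcases isEmpty_or_nonempty Y with he | hne
    · exact ⟨0, le_rfl, fun y => he.elim y⟩
    obtain ⟨y₀, -, hy₀⟩ := LowerSemicontinuousOn.exists_isMinOn univ_nonempty
      (isCompact_univ (X := Y)) (hψ.lsc.lowerSemicontinuousOn univ)
    refine ⟨max 0 (-(ψ y₀).toReal), le_max_left _ _, fun y => ?_⟩
    have h1 : ψ y₀ ≤ ψ y := hy₀ (mem_univ y)
    refine le_trans ?_ h1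
    rw [← EReal.coe_neg]
    refine le_trans (EReal.coe_le_coe_iff.2 (?_ : _ ≤ (ψ y₀).toReal)) ?_
    · linarith [le_max_right 0 (-(ψ y₀).toReal)]
    · exact EReal.coe_toReal_le (hψ.ne_bot y₀)
  · exact ⟨0, le_rfl, fun y => by simpa using hψ.nonneg hc y⟩

end EIntegral

/-! ### Kernels -/

section Kernel

variable {X : Type u} [TopologicalSpace X] {κ : X × X → EReal}

/-- A finite measure of finite energy does not charge the sets of inner capacity zero: its
normalized restriction to such a set would compete in the definition of the capacity. -/
theorem measure_eq_zero_of_capacity_eq_zero [MeasurableSpace X] [LocallyCompactSpace X]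
    [TopologicalSpace.MetrizableSpace X] [SecondCountableTopology X] [BorelSpace X]
    (hκ : IsKernel κ) {μ : RadonMeasure X}
    [IsFiniteMeasure μ.toMeasure] (hμ : FiniteMutualEnergy κ μ μ) {N : Set X}
    (hN : MeasurableSet N) (hcap : capacity κ N = 0) : μ.toMeasure N = 0 := by
  by_contra h0
  set c : ℝ≥0∞ := (μ.toMeasure N)⁻¹
  have hc : c ≠ ∞ := ENNReal.inv_ne_top.2 h0
  have hfin : IsFiniteMeasure (c • μ.toMeasure.restrict N) :=
    Measure.smul_finite _ hc
  let ν : RadonMeasure X := ⟨c • μ.toMeasure.restrict N, inferInstance⟩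
  have hν : ν.toMeasure = c • μ.toMeasure.restrict N := rfl
  have hprod : ν.toMeasure.prod ν.toMeasure =
      (c * c) • (μ.toMeasure.prod μ.toMeasure).restrict (N ×ˢ N) := by
    rw [hν, Measure.prod_smul_left, Measure.prod_smul_right, smul_smul, Measure.prod_restrict]
  have hle : ∀ F : X × X → ℝ≥0∞, ∫⁻ z, F z ∂(μ.toMeasure.prod μ.toMeasure) < ∞ →
      ∫⁻ z, F z ∂(ν.toMeasure.prod ν.toMeasure) < ∞ := by
    intro F hF
    rw [hprod, lintegral_smul_measure]
    exact ENNReal.mul_lt_top (ENNReal.mul_lt_top hc.lt_top hc.lt_top)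
      ((setLIntegral_le_lintegral _ _).trans_lt hF)
  have hνfin : FiniteMutualEnergy κ ν ν :=
    ⟨hκ.psi.lsc.measurable.aemeasurable, hle _ hμ.pos_lt_top, hle _ hμ.neg_lt_top⟩
  have hmem : ν ∈ {ν : RadonMeasure X | CarriedBy ν N ∧ FiniteMutualEnergy κ ν ν ∧
      ν.toMeasure N = 1} := by
    refine ⟨?_, hνfin, ?_⟩
    · rw [CarriedBy, hν, Measure.smul_apply, Measure.restrict_apply hN.compl]
      simp
    · rw [hν, Measure.smul_apply, Measure.restrict_apply_self, smul_eq_mul,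
        ENNReal.inv_mul_cancel h0 (measure_ne_top _ _)]
  obtain ⟨r, hr, hκr⟩ := hνfin.exists_integrable
  have hval : mutualEnergy κ ν ν = _ := (eIntegrable_of_ae_eq hr hκr).2
  rw [capacity, ENNReal.inv_eq_zero] at hcap
  have := iInf₂_le
    (f := fun (ν : RadonMeasure X) (_ : ν ∈ {ν : RadonMeasure X | CarriedBy ν N ∧
      FiniteMutualEnergy κ ν ν ∧ ν.toMeasure N = 1}) => (mutualEnergy κ ν ν).toENNReal) ν hmem
  rw [hcap, hval, EReal.real_coe_toENNReal, top_le_iff] at this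
  exact ENNReal.ofReal_ne_top this

/-- A kernel continuous off the diagonal and vanishing at infinity is bounded on the product of a
compact set and a closed set disjoint from it. -/
theorem exists_bound_prod (hcont : IsContinuousOffDiag κ) (hinf : VanishesAtInfinity κ)
    {K C : Set X} (hK : IsCompact K) (hC : IsClosed C) (hKC : Disjoint K C) :
    ∃ B : ℝ, ∀ x ∈ K, ∀ y ∈ C, -(B : EReal) ≤ κ (x, y) ∧ κ (x, y) ≤ B := by
  obtain ⟨L, hL, hLκ⟩ := mem_cocompact.1 (hinf K hK 1 one_pos)
  have hne : ∀ p ∈ K ×ˢ (L ∩ C), p.1 ≠ p.2 := fun p hp h =>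
    hKC.le_bot ⟨hp.1, h ▸ hp.2.2⟩
  have hc : ContinuousOn (fun p => (κ p).toReal) (K ×ˢ (L ∩ C)) := by
    refine EReal.continuousOn_toReal.comp (hcont.1.mono hne) fun p hp => ?_
    have := hcont.2 p.1 p.2 (hne p hp)
    simpa [and_comm] using this
  obtain ⟨M, hM⟩ := (hK.prod (hL.inter_right hC)).exists_bound_of_continuousOn hc
  refine ⟨max M 1, fun x hx y hy => ?_⟩
  by_cases hyL : y ∈ L
  · have hp : (x, y) ∈ K ×ˢ (L ∩ C) := ⟨hx, hyL, hy⟩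
    have hb := abs_le.1 ((hM _ hp).trans (le_max_left M 1))
    have hfin := hcont.2 x y (hne _ hp)
    rw [← EReal.coe_toReal hfin.1 hfin.2, ← EReal.coe_neg]
    exact ⟨EReal.coe_le_coe_iff.2 hb.1, EReal.coe_le_coe_iff.2 hb.2⟩
  · have h := hLκ hyL x hx
    have h1 : ((1 : ℝ) : EReal) ≤ (max M 1 : ℝ) := EReal.coe_le_coe_iff.2 (le_max_right _ _)
    exact ⟨(EReal.neg_le_neg_iff.2 h1).trans h.1.le, h.2.le.trans h1⟩

/-- A function `ψ ≥ -B` of class `Ψ` gives the lower semicontinuous function `ψ + B ≥ 0`. -/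
theorem IsPsi.exists_lsc_add {Y : Type*} [TopologicalSpace Y] {ψ : Y → EReal} (hψ : IsPsi ψ)
    {B : ℝ} (hB : ∀ y, -(B : EReal) ≤ ψ y) :
    ∃ h : Y → ℝ≥0∞, LowerSemicontinuous h ∧ ∀ y, (h y : EReal) = ψ y + (B : EReal) := by
  refine ⟨fun y => (ψ y + (B : EReal)).toENNReal, ?_, fun y => EReal.coe_toENNReal ?_⟩
  · refine EReal.continuous_toENNReal.comp_lowerSemicontinuous
      (hψ.lsc.add' (g := fun _ => (B : EReal)) lowerSemicontinuous_const fun y => ?_)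
      fun a b hab => EReal.toENNReal_le_toENNReal hab
    exact EReal.continuousAt_add (Or.inr (EReal.coe_ne_bot B)) (Or.inr (EReal.coe_ne_top B))
  · have := add_le_add_left (hB y) (B : EReal)
    rwa [← EReal.coe_neg, ← EReal.coe_add, neg_add_cancel] at this

/-- If `ψ` is continuous and at most `B` on a closed set, then `B - ψ`, extended by `∞` off it, is
lower semicontinuous. -/
theorem exists_lsc_sub {Y : Type*} [TopologicalSpace Y] {ψ : Y → EReal} {F : Set Y}
    (hF : IsClosed F) (hc : ContinuousOn ψ F) {B : ℝ} (hB : ∀ y ∈ F, ψ y ≤ B) :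
    ∃ h : Y → ℝ≥0∞, LowerSemicontinuous h ∧ ∀ y ∈ F, (h y : EReal) = -ψ y + (B : EReal) := by
  classical
  refine ⟨fun y => if y ∈ F then (-ψ y + (B : EReal)).toENNReal else ∞, ?_, fun y hy => ?_⟩
  · have hc' : ContinuousOn (fun y => (-ψ y + (B : EReal)).toENNReal) F := by
      refine EReal.continuous_toENNReal.comp_continuousOn fun y hy => ?_
      have h1 : ContinuousWithinAt (fun y => (-ψ y, (B : EReal))) F y :=
        (continuous_neg.continuousAt.comp_continuousWithinAt (hc y hy)).prodMk
          continuousWithinAt_const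
      exact ContinuousAt.comp_continuousWithinAt (f := fun y => (-ψ y, (B : EReal)))
        (EReal.continuousAt_add (p := (-ψ y, (B : EReal))) (Or.inr (EReal.coe_ne_bot B))
          (Or.inr (EReal.coe_ne_top B))) h1
    rw [lowerSemicontinuous_iff_isClosed_preimage]
    intro t
    by_cases ht : t = ∞
    · simp [ht]
    convert hc'.preimage_isClosed_of_isClosed hF (isClosed_Iic (a := t)) using 1
    ext y
    by_cases hy : y ∈ F <;> simp [hy, ht]
  · simp only [hy, if_true]
    refine EReal.coe_toENNReal ?_
    have := add_le_add_left (EReal.neg_le_neg_iff.2 (hB y hy)) (B : EReal)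
    rwa [← EReal.coe_neg, ← EReal.coe_add, neg_add_cancel] at this

end Kernel

end WeightedEnergy

/-! ### Compact carriers for a condenser with nearly compact plates -/

namespace WeightedEnergy

/-- If finitely many compact sets `A' i`, `i ∈ P`, are disjoint from the others, then the others can
be shrunk, without losing points of the plates, so that the kernel is bounded between the two
groups. The sets to be shrunk are those whose plates avoid a compact neighbourhood `N` of the
compact set `⋃ i ∈ P, A' i`; by local finiteness they are all but finitely many, and they lose the
interior of `N`. -/
theorem exists_compact_carriers_of_finite {X : Type u} [TopologicalSpace X] [LocallyCompactSpace X]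
    [T2Space X] {ι : Type v} {κ : X × X → EReal} (hcont : IsContinuousOffDiag κ)
    (hinf : VanishesAtInfinity κ) {A : ι → Set X}
    (hA : ∀ K : Set X, IsCompact K → {i | (A i ∩ K).Nonempty}.Finite) {A' : ι → Set X}
    (hA' : ∀ i, IsCompact (A' i)) {P : Set ι} (hP : P.Finite)
    (hdisj : ∀ i ∈ P, ∀ j ∉ P, Disjoint (A' i) (A' j)) :
    ∃ (K : ι → Set X) (B : ℝ), (∀ i, IsCompact (K i)) ∧ (∀ i, K i ⊆ A' i) ∧
      (∀ i, A i ∩ A' i ⊆ K i) ∧ ∀ i ∈ P, ∀ j ∉ P, ∀ x ∈ K i, ∀ y ∈ K j,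
        -(B : EReal) ≤ κ (x, y) ∧ κ (x, y) ≤ B := by
  classical
  have hC : IsCompact (⋃ i ∈ P, A' i) := hP.isCompact_biUnion fun i _ => hA' i
  obtain ⟨N, hN, hCN⟩ := exists_compact_superset hC
  set J : Set ι := {j | j ∉ P ∧ (A j ∩ N).Nonempty}
  have hJ : J.Finite := (hA N hN).subset fun j hj => hj.2
  have hF : IsClosed ((⋃ j ∈ J, A' j) ∪ (interior N)ᶜ) :=
    (hJ.isClosed_biUnion fun j _ => (hA' j).isClosed).union isOpen_interior.isClosed_compl
  have hd : Disjoint (⋃ i ∈ P, A' i) ((⋃ j ∈ J, A' j) ∪ (interior N)ᶜ) := by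
    rw [disjoint_union_right]
    refine ⟨?_, disjoint_compl_right_iff_subset.2 hCN⟩
    simp only [disjoint_iUnion_left, disjoint_iUnion_right]
    exact fun j hj i hi => hdisj i hi j hj.1
  obtain ⟨B, hB⟩ := exists_bound_prod hcont hinf hC hF hd
  refine ⟨fun i => if i ∈ P ∨ i ∈ J then A' i else A' i \ interior N, B, fun i => ?_, fun i => ?_,
    fun i => ?_, fun i hi j hj x hx y hy => ?_⟩
  · dsimp only
    split_ifs
    exacts [hA' i, (hA' i).diff isOpen_interior]
  · dsimp only
    split_ifs
    exacts [subset_rfl, sdiff_subset]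
  · dsimp only
    split_ifs with h
    · exact inter_subset_right
    · refine fun x hx => ⟨hx.2, fun hxN => h ?_⟩
      by_cases hi : i ∈ P
      · exact Or.inl hi
      · exact Or.inr ⟨hi, x, hx.1, interior_subset hxN⟩
  · simp only [hi, true_or, if_true] at hx
    simp only [hj, false_or] at hy
    refine hB x (mem_biUnion hi hx) y ?_
    split_ifs at hy with h
    · exact Or.inl (mem_biUnion h hy)
    · exact Or.inr hy.2

section Carriers

variable {X : Type u} [TopologicalSpace X] [MeasurableSpace X] {ι : Type v}
  {κ : X × X → EReal}

/-- The external fields have a common lower bound: they are nonnegative unless `X` is compact, and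
then there are only finitely many of them. -/
theorem exists_common_lower_bound (A : Condenser X ι) {f : ι → X → EReal} (hf : ∀ i, IsPsi (f i)) :
    ∃ C : ℝ, ∀ i x, -(C : EReal) ≤ f i x := by
  by_cases hX : CompactSpace X
  · have hfin : Finite ι := by
      have := A.locallyFinite univ isCompact_univ
      simpa [A.nonempty_plate, Set.finite_univ_iff] using this
    choose c hc0 hc using fun i => (hf i).exists_lower_bound
    obtain ⟨C, hC⟩ := (Set.finite_range c).bddAbove
    exact ⟨C, fun i x => (EReal.neg_le_neg_iff.2
      (EReal.coe_le_coe_iff.2 (hC (mem_range_self i)))).trans (hc i x)⟩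
  · exact ⟨0, fun i x => by simpa using (hf i).nonneg hX x⟩

variable [LocallyCompactSpace X] [T2Space X]

/-- For each pair of plates the signed kernel `s_i s_j κ` becomes, after adding a constant `B`
common to all pairs, a nonnegative lower semicontinuous kernel `h (i, j)`, at least on the compact
carriers. For plates of the same sign this is the lower bound for `κ`; for plates of opposite signs
it is the boundedness and continuity of `κ` between the carriers. -/
theorem exists_compact_carriers (hκ : IsKernel κ) (hcont : IsContinuousOffDiag κ)
    (hinf : VanishesAtInfinity κ) (A : Condenser X ι) (hfin : A.pos.Finite ∨ A.posᶜ.Finite)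
    {A' : ι → Set X} (hA' : ∀ i, IsCompact (A' i))
    (hdisj : Disjoint (⋃ i ∈ A.pos, A' i) (⋃ i ∈ A.posᶜ, A' i)) :
    ∃ (K : ι → Set X) (B : ℝ) (h : ι × ι → X × X → ℝ≥0∞), (∀ i, IsCompact (K i)) ∧
      (∀ i, K i ⊆ A' i) ∧ (∀ i, A.plate i ∩ A' i ⊆ K i) ∧ (∀ p, LowerSemicontinuous (h p)) ∧
      ∀ p, ∀ z ∈ K p.1 ×ˢ K p.2,
        (h p z : EReal) = ((A.sign p.1 * A.sign p.2 : ℝ) : EReal) * κ z + (B : EReal) := by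
  have hd : ∀ i ∈ A.pos, ∀ j ∉ A.pos, Disjoint (A' i) (A' j) := fun i hi j hj =>
    hdisj.mono (subset_biUnion_of_mem (u := A') hi)
      (subset_biUnion_of_mem (s := A.posᶜ) (u := A') hj)
  obtain ⟨K, B₀, hK, hKA', hKA, hB₀⟩ : ∃ (K : ι → Set X) (B : ℝ), (∀ i, IsCompact (K i)) ∧
      (∀ i, K i ⊆ A' i) ∧ (∀ i, A.plate i ∩ A' i ⊆ K i) ∧
      ∀ i ∈ A.pos, ∀ j ∉ A.pos, ∀ x ∈ K i, ∀ y ∈ K j,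
        -(B : EReal) ≤ κ (x, y) ∧ κ (x, y) ≤ B := by
    rcases hfin with hfin | hfin
    · exact exists_compact_carriers_of_finite hcont hinf A.locallyFinite hA' hfin hd
    · obtain ⟨K, B, h1, h2, h3, h4⟩ := exists_compact_carriers_of_finite hcont hinf
        A.locallyFinite hA' hfin fun i hi j hj => (hd j (not_not.1 hj) i hi).symm
      exact ⟨K, B, h1, h2, h3, fun i hi j hj x hx y hy =>
        hκ.symm x y ▸ h4 j hj i (not_not.2 hi) y hy x hx⟩
  obtain ⟨c, -, hc⟩ := hκ.psi.exists_lower_bound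
  have hcB : ∀ z, -((max c B₀ : ℝ) : EReal) ≤ κ z := fun z =>
    (EReal.neg_le_neg_iff.2 (EReal.coe_le_coe_iff.2 (le_max_left _ _))).trans (hc z)
  have key : ∀ p : ι × ι, ∃ h : X × X → ℝ≥0∞, LowerSemicontinuous h ∧ ∀ z ∈ K p.1 ×ˢ K p.2,
      (h z : EReal) = ((A.sign p.1 * A.sign p.2 : ℝ) : EReal) * κ z + ((max c B₀ : ℝ) : EReal) := by
    intro p
    by_cases hs : p.1 ∈ A.pos ↔ p.2 ∈ A.pos
    · obtain ⟨h, hh, hh'⟩ := hκ.psi.exists_lsc_add hcB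
      refine ⟨h, hh, fun z _ => ?_⟩
      have : A.sign p.1 * A.sign p.2 = 1 := by
        unfold Condenser.sign
        by_cases h2 : p.2 ∈ A.pos <;> simp [hs, h2]
      rw [hh', this, EReal.coe_one, one_mul]
    · have hsign : A.sign p.1 * A.sign p.2 = -1 := by
        unfold Condenser.sign
        by_cases h2 : p.2 ∈ A.pos <;> simp_all
      have hle : Disjoint (K p.1) (K p.2) ∧ ∀ z ∈ K p.1 ×ˢ K p.2, κ z ≤ B₀ := by
        by_cases h1 : p.1 ∈ A.pos
        · have h2 : p.2 ∉ A.pos := fun h2 => hs ⟨fun _ => h2, fun _ => h1⟩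
          exact ⟨(hd _ h1 _ h2).mono (hKA' _) (hKA' _),
            fun z hz => (hB₀ _ h1 _ h2 z.1 hz.1 z.2 hz.2).2⟩
        · have h2 : p.2 ∈ A.pos := by
            by_contra h2
            exact hs ⟨fun h => (h1 h).elim, fun h => (h2 h).elim⟩
          exact ⟨((hd _ h2 _ h1).mono (hKA' _) (hKA' _)).symm, fun z hz =>
            hκ.symm z.1 z.2 ▸ (hB₀ _ h2 _ h1 z.2 hz.2 z.1 hz.1).2⟩
      obtain ⟨h, hh, hh'⟩ := exists_lsc_sub ((hK p.1).prod (hK p.2)).isClosed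
        (hcont.1.mono fun z hz h => hle.1.le_bot ⟨hz.1, h ▸ hz.2⟩)
        (B := max c B₀) fun z hz => (hle.2 z hz).trans (EReal.coe_le_coe_iff.2 (le_max_right _ _))
      refine ⟨h, hh, fun z hz => ?_⟩
      rw [hh' z hz, hsign, EReal.coe_neg, EReal.coe_one, neg_one_mul]
  choose h hh hh' using key
  exact ⟨K, max c B₀, h, hK, hKA', hKA, hh, hh'⟩

end Carriers

/-! ### Minimizing a lower semicontinuous functional on a compact set -/

/-- Let `G` be an extended real valued function, lower semicontinuous on a closed compact set `D`,
which is `∞` exactly at the points of `D` outside the subset `E`. Then the minimizers of `G` on `E`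
form a nonempty compact set which contains the cluster points of all minimizing nets. -/
theorem minimizers_of_lowerSemicontinuousOn {M : Type*} [TopologicalSpace M] {D E : Set M}
    (hD : IsCompact D) (hDc : IsClosed D) (hED : E ⊆ D) (hE : E.Nonempty) {G : M → EReal}
    (hG : LowerSemicontinuousOn G D) (hGE : ∀ μ ∈ E, G μ ≠ ⊤) (hGD : ∀ μ ∈ D, μ ∉ E → G μ = ⊤) :
    {μ | μ ∈ E ∧ G μ = ⨅ ν ∈ E, G ν}.Nonempty ∧ IsCompact {μ | μ ∈ E ∧ G μ = ⨅ ν ∈ E, G ν} ∧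
      ∀ {S : Type w} [Preorder S] (μ : S → M), (∀ s, μ s ∈ E) →
        Tendsto (fun s => G (μ s)) atTop (𝓝 (⨅ ν ∈ E, G ν)) → ∀ l, MapClusterPt l atTop μ →
          l ∈ {μ | μ ∈ E ∧ G μ = ⨅ ν ∈ E, G ν} := by
  set m := ⨅ ν ∈ E, G ν
  obtain ⟨ν₀, hν₀⟩ := hE
  have hm : m < ⊤ := (iInf₂_le ν₀ hν₀).trans_lt (hGE ν₀ hν₀).lt_top
  have hset : {μ | μ ∈ E ∧ G μ = m} = D ∩ G ⁻¹' Iic m := by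
    ext μ
    constructor
    · rintro ⟨h1, h2⟩
      exact ⟨hED h1, h2.le⟩
    · rintro ⟨h1, h2⟩
      have hμE : μ ∈ E := by
        by_contra h
        rw [mem_preimage, hGD μ h1 h] at h2
        exact (lt_of_le_of_lt h2 hm).false
      exact ⟨hμE, le_antisymm h2 (iInf₂_le μ hμE)⟩
  refine ⟨?_, ?_, ?_⟩
  · obtain ⟨μ, hμD, hμ⟩ := hG.exists_isMinOn ⟨ν₀, hED hν₀⟩ hD
    exact hset ▸ ⟨μ, hμD, show G μ ≤ m from le_iInf₂ fun ν hν => hμ (hED hν)⟩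
  · exact hset ▸ hG.isCompact_inter_preimage_Iic hD m
  · intro S _ μ hμ hlim l hl
    rw [hset]
    obtain ⟨U, hU, hUl⟩ := mapClusterPt_iff_ultrafilter.1 hl
    have hlD : l ∈ D := hDc.mem_of_tendsto hUl (Eventually.of_forall fun s => hED (hμ s))
    refine ⟨hlD, show G l ≤ m from le_of_forall_lt fun y hy => ?_⟩
    have hUl' : Tendsto μ U (𝓝[D] l) :=
      tendsto_nhdsWithin_iff.2 ⟨hUl, Eventually.of_forall fun s => hED (hμ s)⟩
    obtain ⟨t, hyt, ht⟩ := exists_between hy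
    exact hyt.trans_le (ge_of_tendsto (hlim.mono_left hU)
      ((hUl'.eventually (hG l hlD t ht)).mono fun s hs => hs.le))

end WeightedEnergy

/-! ### The weighted energy as a difference of a lower semicontinuous and a continuous term -/

namespace WeightedEnergy

/-- Summation of the identities `e j = ±k j + t j`, for nonnegative and possibly infinite `e j`. -/
theorem tsum_affine {J : Type*} {e : J → ℝ≥0∞} {σ k t : J → ℝ} (hσ : ∀ j, |σ j| = 1)
    (ht : Summable t) (he : ∀ j, e j < ∞ ∧ (e j).toReal = σ j * k j + t j)
    (hk : Summable fun j => |k j|) :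
    ∑' j, e j < ∞ ∧ (∑' j, e j).toReal = ∑' j, σ j * k j + ∑' j, t j := by
  have hk' : Summable fun j => σ j * k j :=
    Summable.of_abs (hk.congr fun j => by rw [abs_mul, hσ, one_mul])
  have hs : Summable fun j => (e j).toReal := (hk'.add ht).congr fun j => ((he j).2).symm
  have hnn : ∀ j, ((e j).toNNReal : ℝ≥0∞) = e j := fun j => ENNReal.coe_toNNReal (he j).1.ne
  refine ⟨?_, ?_⟩
  · rw [← tsum_congr hnn]
    exact (ENNReal.tsum_coe_ne_top_iff_summable.2 (NNReal.summable_coe.1 hs)).lt_top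
  · rw [ENNReal.tsum_toReal_eq fun j => (he j).1.ne, tsum_congr fun j => (he j).2,
      hk'.tsum_add ht]

theorem summable_abs_of_affine {J : Type*} {e : J → ℝ≥0∞} {σ k t : J → ℝ} (hσ : ∀ j, |σ j| = 1)
    (ht : Summable t) (he : ∀ j, (e j).toReal = σ j * k j + t j) (hfin : ∑' j, e j < ∞) :
    Summable fun j => |k j| :=
  (((ENNReal.summable_toReal hfin.ne).sub ht).abs).congr fun j => by
    rw [he, add_sub_cancel_right, abs_mul, hσ, one_mul]

variable {X : Type u} [TopologicalSpace X] [MeasurableSpace X] {ι : Type v}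

theorem Condenser.sign_eq_or (A : Condenser X ι) (p : ι × ι) :
    A.sign p.1 * A.sign p.2 = 1 ∨ A.sign p.1 * A.sign p.2 = -1 := by
  unfold Condenser.sign
  by_cases h1 : p.1 ∈ A.pos <;> by_cases h2 : p.2 ∈ A.pos <;> simp [h1, h2]

/-- The total mass of all components of a vector measure, meaningful if their masses are finite and
summable. -/
noncomputable def totalMass (μ : VectorMeasures X ι) : ℝ := ∑' i, (μ i).toMeasure.real univ

theorem summable_mass {m : ι → ℝ≥0} {μ : VectorMeasures X ι} (hm : Summable m)
    (hμ : ∀ i, (μ i).toMeasure univ ≤ m i) :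
    Summable fun i => (μ i).toMeasure.real univ :=
  (NNReal.summable_coe.2 hm).of_nonneg_of_le (fun _ => measureReal_nonneg)
    fun i => ENNReal.toReal_le_coe_of_le_coe (hμ i)

/-- The sum of the integrals of nonnegative pair kernels `h` and nonnegative fields `φ`. With `h`
and `φ` obtained from the signed kernels and the fields by adding constants, it differs from the
weighted energy by a polynomial in the total mass. -/
noncomputable def shiftedEnergy (h : ι × ι → X × X → ℝ≥0∞) (φ : ι → X → ℝ≥0∞)
    (μ : VectorMeasures X ι) : ℝ≥0∞ :=
  ∑' p : ι × ι, ∫⁻ z, h p z ∂((μ p.1).toMeasure.prod (μ p.2).toMeasure) +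
    2 * ∑' i, ∫⁻ x, φ i x ∂(μ i).toMeasure

/-- Vector measures with prescribed compact carriers, masses at most `m i`, satisfying the
normalizations `⟨g i, μ i⟩ = a i` and the upper constraints: the admissibility conditions other than
finiteness of the energies. -/
def carriedClass (K : ι → Set X) (m : ι → ℝ≥0) (a : ι → ℝ) (g : ι → X → ℝ) (I₀ : Set ι)
    (ξ : ι → RadonMeasure X) : Set (VectorMeasures X ι) :=
  univ.pi fun i => {μ | (μ.toMeasure (K i)ᶜ = 0 ∧ μ.toMeasure univ ≤ m i) ∧
    pairing (g i) μ = ENNReal.ofReal (a i) ∧ (i ∈ I₀ → μ.toMeasure ≤ (ξ i).toMeasure)}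

variable [LocallyCompactSpace X] [TopologicalSpace.MetrizableSpace X] [BorelSpace X]
  {κ : X × X → EReal} {A : Condenser X ι} {f : ι → X → EReal} {a : ι → ℝ}
  {g : ι → X → ℝ} {I₀ : Set ι} {ξ : ι → RadonMeasure X} {K : ι → Set X} {m : ι → ℝ≥0}
  {h : ι × ι → X × X → ℝ≥0∞} {φ : ι → X → ℝ≥0∞} {B C : ℝ} {μ : VectorMeasures X ι}

theorem continuousOn_totalMass (hK : ∀ i, IsCompact (K i)) (hm : Summable m) :
    ContinuousOn (totalMass : VectorMeasures X ι → ℝ) (carriedClass K m a g I₀ ξ) := by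
  refine continuousOn_tsum (u := fun i => (m i : ℝ)) (fun i => ?_) (NNReal.summable_coe.2 hm)
    fun i μ hμ => ?_
  · have h1 : ContinuousOn (fun μ : VectorMeasures X ι => (μ i).toMeasure univ)
        (carriedClass K m a g I₀ ξ) := by
      have h2 := (RadonMeasure.continuousOn_lintegral (hK i)
        (continuous_const (y := (1 : ℝ≥0)))).comp (continuous_apply i).continuousOn
        (s := carriedClass K m a g I₀ ξ) fun μ hμ => (hμ i (mem_univ i)).1.1
      simpa [Function.comp_def] using h2
    exact ENNReal.continuousOn_toReal.comp h1 fun μ hμ =>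
      ((hμ i (mem_univ i)).1.2.trans_lt ENNReal.coe_lt_top).ne
  · rw [Real.norm_of_nonneg measureReal_nonneg]
    exact ENNReal.toReal_le_coe_of_le_coe (hμ i (mem_univ i)).1.2

variable [SecondCountableTopology X]

theorem isCompact_carriedClass (hK : ∀ i, IsCompact (K i)) (hg : ∀ i, Continuous (g i)) :
    IsCompact (carriedClass K m a g I₀ ξ) := by
  refine isCompact_univ_pi fun i => ?_
  have h1 := RadonMeasure.isCompact_setOf_mass_le (hK i) (m i)
  have hcont : ContinuousOn (pairing (g i)) {μ : RadonMeasure X | μ.toMeasure (K i)ᶜ = 0 ∧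
      μ.toMeasure univ ≤ m i} :=
    (RadonMeasure.continuousOn_lintegral (hK i)
      (continuous_real_toNNReal.comp (hg i))).mono fun μ hμ => hμ.1
  have h2 := hcont.preimage_isClosed_of_isClosed h1.isClosed
    (isClosed_singleton (x := ENNReal.ofReal (a i)))
  refine h1.of_isClosed_subset ?_ fun μ hμ => hμ.1
  by_cases hi : i ∈ I₀
  · convert RadonMeasure.isClosed_setOf_le_inter (hK i) h2 (fun μ hμ => hμ.1.1) (ξ i) using 1
    ext μ
    simp [hi, and_assoc]
  · convert h2 using 1
    ext μ
    simp [hi]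

theorem lowerSemicontinuousOn_shiftedEnergy (hK : ∀ i, IsCompact (K i))
    (hh : ∀ p, LowerSemicontinuous (h p)) (hφ : ∀ i, LowerSemicontinuous (φ i)) :
    LowerSemicontinuousOn (shiftedEnergy h φ) (carriedClass K m a g I₀ ξ) := by
  have h2 : LowerSemicontinuousOn (fun μ : VectorMeasures X ι =>
      ∑' i, ∫⁻ x, φ i x ∂(μ i).toMeasure) (carriedClass K m a g I₀ ξ) :=
    lowerSemicontinuousOn_tsum fun i =>
      (RadonMeasure.lowerSemicontinuousOn_lintegral (hK i) (hφ i)).comp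
        (continuous_apply i).continuousOn fun μ hμ => (hμ i (mem_univ i)).1.1
  refine LowerSemicontinuousOn.add (lowerSemicontinuousOn_tsum fun p => ?_) ?_
  · exact (RadonMeasure.lowerSemicontinuousOn_lintegral_prod (hK p.1) (hK p.2) (hh p)).comp
      (g := fun μ : VectorMeasures X ι => (μ p.1, μ p.2))
      ((continuous_apply p.1).prodMk (continuous_apply p.2)).continuousOn
      fun μ hμ => ⟨(hμ p.1 (mem_univ _)).1.1, (hμ p.2 (mem_univ _)).1.1⟩
  · exact (ENNReal.continuous_const_mul (by simp)).comp_lowerSemicontinuousOn h2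
      fun x y hxy => mul_le_mul_right hxy 2

/-- The mutual energies of two measures carried by compact sets, read off from a nonnegative
kernel. -/
theorem mutualEnergy_affine {μ ν : RadonMeasure X} {K L : Set X} (hK : IsCompact K)
    (hL : IsCompact L) (hμ : μ.toMeasure Kᶜ = 0) (hν : ν.toMeasure Lᶜ = 0) {h : X × X → ℝ≥0∞}
    (hh : LowerSemicontinuous h) {σ B : ℝ} (hσ : σ = 1 ∨ σ = -1)
    (hh' : ∀ z ∈ K ×ˢ L, (h z : EReal) = (σ : EReal) * κ z + (B : EReal)) :
    (∫⁻ z, h z ∂(μ.toMeasure.prod ν.toMeasure) < ∞ → FiniteMutualEnergy κ μ ν) ∧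
    (FiniteMutualEnergy κ μ ν → ∫⁻ z, h z ∂(μ.toMeasure.prod ν.toMeasure) < ∞ ∧
      (∫⁻ z, h z ∂(μ.toMeasure.prod ν.toMeasure)).toReal =
        σ * (mutualEnergy κ μ ν).toReal +
          B * (μ.toMeasure.real univ * ν.toMeasure.real univ)) := by
  have := RadonMeasure.isFiniteMeasure hK hμ
  have := RadonMeasure.isFiniteMeasure hL hν
  have hae : ∀ᵐ z ∂(μ.toMeasure.prod ν.toMeasure), z ∈ K ×ˢ L := by
    rw [← RadonMeasure.restrict_eq_self hμ, ← RadonMeasure.restrict_eq_self hν,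
      Measure.prod_restrict]
    exact ae_restrict_mem (hK.measurableSet.prod hL.measurableSet)
  have hae' := hae.mono hh'
  refine ⟨eIntegrable_of_lintegral_affine hσ hh.measurable.aemeasurable hae', fun hfin => ?_⟩
  have := EIntegrable.lintegral_affine hae' hfin
  rwa [← univ_prod_univ, measureReal_prod_prod] at this

/-- A vector measure of the class `carriedClass` which has finite shifted energy is admissible: the
finiteness of the energies of its components makes them vanish off the plates. -/
theorem mem_admissible_of_shiftedEnergy_lt_top (hκ : IsKernel κ) {A' : ι → Set X}
    (hA' : ∀ i, IsNearlyCompactVia κ (A.plate i) (A' i)) (hK : ∀ i, IsCompact (K i))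
    (hKA' : ∀ i, K i ⊆ A' i)
    (hh : ∀ p, LowerSemicontinuous (h p)) (hφ : ∀ i, LowerSemicontinuous (φ i))
    (hh' : ∀ p, ∀ z ∈ K p.1 ×ˢ K p.2,
      (h p z : EReal) = ((A.sign p.1 * A.sign p.2 : ℝ) : EReal) * κ z + (B : EReal))
    (hφ' : ∀ i x, (φ i x : EReal) = f i x + (C : EReal)) (hm : Summable m)
    (hμ : μ ∈ carriedClass K m a g I₀ ξ) (hfin : shiftedEnergy h φ μ < ∞) :
    μ ∈ admissible κ A f a g I₀ ξ := by
  have hmass := summable_mass hm fun i => (hμ i (mem_univ i)).1.2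
  have hfinμ : ∀ i, IsFiniteMeasure (μ i).toMeasure := fun i =>
    RadonMeasure.isFiniteMeasure (hK i) (hμ i (mem_univ i)).1.1
  obtain ⟨hfin1, hfin2⟩ := ENNReal.add_lt_top.1 hfin
  replace hfin2 : ∑' i, ∫⁻ x, φ i x ∂(μ i).toMeasure < ∞ :=
    lt_of_le_of_lt (le_mul_of_one_le_left zero_le one_le_two) hfin2
  have hE := fun p : ι × ι => mutualEnergy_affine (hK p.1) (hK p.2) (hμ p.1 (mem_univ _)).1.1
    (hμ p.2 (mem_univ _)).1.1 (hh p) (A.sign_eq_or p) (hh' p)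
  have hFE : ∀ p : ι × ι, FiniteMutualEnergy κ (μ p.1) (μ p.2) := fun p =>
    (hE p).1 ((ENNReal.le_tsum p).trans_lt hfin1)
  have hφ'' : ∀ i, ∀ᵐ x ∂(μ i).toMeasure,
      (φ i x : EReal) = ((1 : ℝ) : EReal) * f i x + (C : EReal) := fun i =>
    Eventually.of_forall fun x => by rw [hφ', EReal.coe_one, one_mul]
  have hFI : ∀ i, EIntegrable (f i) (μ i).toMeasure := fun i =>
    eIntegrable_of_lintegral_affine (Or.inl rfl) (hφ i).measurable.aemeasurable (hφ'' i)
      ((ENNReal.le_tsum i).trans_lt hfin2)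
  -- The measure `μ i` vanishes off `K i` and on the symmetric difference of `A i` and `A' i ⊇ K i`.
  refine ⟨⟨fun i => ?_, fun i j => hFE (i, j), ?_⟩, ⟨hFI, ?_⟩,
    fun i => (hμ i (mem_univ i)).2.1, fun i => (hμ i (mem_univ i)).2.2⟩
  · have h0 := measure_eq_zero_of_capacity_eq_zero hκ (hFE (i, i))
      ((A.measurableSet_plate i).symmDiff (hA' i).isCompact.measurableSet)
      (hA' i).capacity_symmDiff
    refine measure_mono_null (fun x hx => ?_) (measure_union_null h0 (hμ i (mem_univ i)).1.1)
    by_cases hxK : x ∈ K i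
    · exact Or.inl (Or.inr ⟨hKA' i hxK, hx⟩)
    · exact Or.inr hxK
  · exact summable_abs_of_affine (fun p => by rcases A.sign_eq_or p with h | h <;> simp [h])
      ((hmass.mul_of_nonneg hmass (fun _ => measureReal_nonneg)
        fun _ => measureReal_nonneg).mul_left B) (fun p => ((hE p).2 (hFE p)).2) hfin1
  · exact summable_abs_of_affine (σ := fun _ => 1) (fun i => abs_one) (hmass.mul_left C)
      (fun i => ((hFI i).lintegral_affine (hφ'' i)).2) hfin2

/-- On admissible vector measures the weighted energy is the shifted energy minus a polynomial in
the total mass. -/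
theorem weightedEnergy_eq (hK : ∀ i, IsCompact (K i)) (hh : ∀ p, LowerSemicontinuous (h p))
    (hh' : ∀ p, ∀ z ∈ K p.1 ×ˢ K p.2,
      (h p z : EReal) = ((A.sign p.1 * A.sign p.2 : ℝ) : EReal) * κ z + (B : EReal))
    (hφ' : ∀ i x, (φ i x : EReal) = f i x + (C : EReal)) (hm : Summable m)
    (hμ : μ ∈ carriedClass K m a g I₀ ξ) (hμE : μ ∈ admissible κ A f a g I₀ ξ) :
    shiftedEnergy h φ μ < ∞ ∧ (shiftedEnergy h φ μ).toReal =
      weightedEnergy κ A f μ + (B * totalMass μ ^ 2 + 2 * (C * totalMass μ)) := by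
  have hmass := summable_mass hm fun i => (hμ i (mem_univ i)).1.2
  have hfinμ : ∀ i, IsFiniteMeasure (μ i).toMeasure := fun i =>
    RadonMeasure.isFiniteMeasure (hK i) (hμ i (mem_univ i)).1.1
  obtain ⟨hE, hF, -, -⟩ := hμE
  have hmass2 := hmass.mul_of_nonneg hmass (fun _ => measureReal_nonneg)
    fun _ => measureReal_nonneg
  have h1 := tsum_affine (σ := fun p : ι × ι => A.sign p.1 * A.sign p.2)
    (fun p => by rcases A.sign_eq_or p with h | h <;> simp [h]) (hmass2.mul_left B)
    (fun p => (mutualEnergy_affine (hK p.1) (hK p.2) (hμ p.1 (mem_univ _)).1.1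
      (hμ p.2 (mem_univ _)).1.1 (hh p) (A.sign_eq_or p) (hh' p)).2 (hE.finite p.1 p.2)) hE.summable
  have h2 := tsum_affine (σ := fun _ : ι => 1) (fun i => abs_one) (hmass.mul_left C)
    (fun i => (hF.integrable i).lintegral_affine (h := φ i) (σ := 1) (Eventually.of_forall
      fun x => by rw [hφ', EReal.coe_one, one_mul])) hF.summable
  have h3 : ∑' p : ι × ι, (μ p.1).toMeasure.real univ * (μ p.2).toMeasure.real univ =
      totalMass μ ^ 2 := by
    rw [sq, totalMass, hmass.tsum_mul_tsum hmass hmass2]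
  have h5 : ∑' p : ι × ι, B * ((μ p.1).toMeasure.real univ * (μ p.2).toMeasure.real univ) =
      B * totalMass μ ^ 2 := by
    rw [tsum_mul_left, h3]
  have h6 : ∑' i, C * (μ i).toMeasure.real univ = C * totalMass μ := tsum_mul_left
  have h4 : 2 * ∑' i, ∫⁻ x, φ i x ∂(μ i).toMeasure < ∞ := ENNReal.mul_lt_top (by simp) h2.1
  refine ⟨ENNReal.add_lt_top.2 ⟨h1.1, h4⟩, ?_⟩
  rw [shiftedEnergy, ENNReal.toReal_add h1.1.ne h4.ne, ENNReal.toReal_mul, h1.2, h2.2,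
    h5, h6, weightedEnergy, energy]
  simp only [one_mul, ENNReal.toReal_ofNat]
  ring

/-- Admissible vector measures are carried by the compact sets `K i`, and their masses are bounded
by `a i / inf g i`. -/
theorem admissible_subset_carriedClass (hκ : IsKernel κ) {A' : ι → Set X}
    (hA' : ∀ i, IsNearlyCompactVia κ (A.plate i) (A' i)) (hKA : ∀ i, A.plate i ∩ A' i ⊆ K i)
    (hm : ∀ i, ENNReal.ofReal (a i) / (⨅ x ∈ A.plate i, ENNReal.ofReal (g i x)) = m i)
    (ha : ∀ i, 0 < a i) :
    admissible κ A f a g I₀ ξ ⊆ carriedClass K m a g I₀ ξ := by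
  rintro μ ⟨hE, -, hg, hξ⟩ i -
  have hmass : (μ i).toMeasure univ ≤ m i := by
    have hae : ∀ᵐ x ∂(μ i).toMeasure, x ∈ A.plate i := hE.carried i
    have hle : (⨅ x ∈ A.plate i, ENNReal.ofReal (g i x)) * (μ i).toMeasure univ ≤
        ENNReal.ofReal (a i) := by
      rw [← hg i, pairing, ← lintegral_const]
      exact lintegral_mono_ae (hae.mono fun x hx => iInf₂_le x hx)
    have ha0 : ENNReal.ofReal (a i) ≠ 0 := (ENNReal.ofReal_pos.2 (ha i)).ne'
    rw [← hm i, ENNReal.le_div_iff_mul_le (Or.inr ha0) (Or.inr ENNReal.ofReal_ne_top), mul_comm]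
    exact hle
  have hfin : IsFiniteMeasure (μ i).toMeasure := ⟨hmass.trans_lt ENNReal.coe_lt_top⟩
  have h0 := measure_eq_zero_of_capacity_eq_zero hκ (hE.finite i i)
    ((A.measurableSet_plate i).symmDiff (hA' i).isCompact.measurableSet)
    (hA' i).capacity_symmDiff
  refine ⟨⟨measure_mono_null (fun x hx => ?_) (measure_union_null h0 (hE.carried i)), hmass⟩,
    hg i, hξ i⟩
  by_cases hxA : x ∈ A.plate i
  · exact Or.inl (Or.inl ⟨hxA, fun hx' => hx (hKA i ⟨hxA, hx'⟩)⟩)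
  · exact Or.inr hxA

end WeightedEnergy

theorem theorem6p3 {X : Type u} [TopologicalSpace X] [LocallyCompactSpace X]
    [TopologicalSpace.MetrizableSpace X] [SigmaCompactSpace X] [MeasurableSpace X] [BorelSpace X]
    {ι : Type v} [Countable ι]
    (κ : X × X → EReal) (hκ : WeightedEnergy.IsKernel κ)
    (hκpd : WeightedEnergy.IsPositiveDefinite κ)
    (hκcont : WeightedEnergy.IsContinuousOffDiag κ)
    (hκinf : WeightedEnergy.VanishesAtInfinity κ)
    (A : WeightedEnergy.Condenser X ι)
    (hfin : A.pos.Finite ∨ A.posᶜ.Finite)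
    (A' : ι → Set X)
    (hA' : ∀ i, WeightedEnergy.IsNearlyCompactVia κ (A.plate i) (A' i))
    (hdisj : Disjoint (⋃ i ∈ A.pos, A' i) (⋃ i ∈ A.posᶜ, A' i))
    (f : ι → X → EReal) (hf : ∀ i, WeightedEnergy.IsPsi (f i))
    (a : ι → ℝ) (ha : ∀ i, 0 < a i)
    (g : ι → X → ℝ) (hgcont : ∀ i, Continuous (g i)) (hgpos : ∀ i x, 0 < g i x)
    (hsum : ∑' i, ENNReal.ofReal (a i) / (⨅ x ∈ A.plate i, ENNReal.ofReal (g i x)) < ⊤)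
    (I₀ : Set ι) (ξ : ι → WeightedEnergy.RadonMeasure X)
    (hξ : ∀ i ∈ I₀, WeightedEnergy.IsConstraint (A.plate i) (a i) (g i) (ξ i))
    (hne : (WeightedEnergy.admissible κ A f a g I₀ ξ).Nonempty) :
    (WeightedEnergy.solutions κ A f a g I₀ ξ).Nonempty ∧
      IsCompact (WeightedEnergy.solutions κ A f a g I₀ ξ) ∧
      WeightedEnergy.solutions κ A f a g I₀ ξ =
        WeightedEnergy.minimizingClusterPoints.{u, v, w} κ A f a g I₀ ξ := by
  open WeightedEnergy in
  have : SecondCountableTopology X := by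
    let _ : MetricSpace X := TopologicalSpace.metrizableSpaceMetric X
    exact EMetric.secondCountable_of_sigmaCompact X
  obtain ⟨K, B, h, hK, hKA', hKA, hh, hh'⟩ := exists_compact_carriers hκ hκcont hκinf A hfin
    (fun i => (hA' i).isCompact) hdisj
  obtain ⟨C, hC⟩ := exists_common_lower_bound A hf
  choose φ hφ hφ' using fun i => (hf i).exists_lsc_add (hC i)
  have htop := ENNReal.ne_top_of_tsum_ne_top hsum.ne
  lift (fun i => ENNReal.ofReal (a i) / (⨅ x ∈ A.plate i, ENNReal.ofReal (g i x))) to ι → ℝ≥0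
    using htop with m hm
  have hms : Summable m := by
    rw [← ENNReal.tsum_coe_ne_top_iff_summable]
    exact hsum.ne
  set E := admissible κ A f a g I₀ ξ
  set D := carriedClass K m a g I₀ ξ
  have hED : E ⊆ D := admissible_subset_carriedClass hκ hA' hKA (fun i => (congrFun hm i).symm) ha
  let q : VectorMeasures X ι → ℝ := fun μ => B * totalMass μ ^ 2 + 2 * (C * totalMass μ)
  let G : VectorMeasures X ι → EReal := fun μ => shiftedEnergy h φ μ + ((-q μ : ℝ) : EReal)
  have hq : ContinuousOn q D := by
    have := continuousOn_totalMass (X := X) (a := a) (g := g) (I₀ := I₀) (ξ := ξ) hK hms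
    exact (continuousOn_const.mul (this.pow 2)).add
      (continuousOn_const.mul (continuousOn_const.mul this))
  have hG : LowerSemicontinuousOn G D := by
    refine LowerSemicontinuousOn.add' ?_ ?_ fun μ _ =>
      EReal.continuousAt_add (Or.inr (EReal.coe_ne_bot _)) (Or.inr (EReal.coe_ne_top _))
    · exact continuous_coe_ennreal_ereal.comp_lowerSemicontinuousOn
        (lowerSemicontinuousOn_shiftedEnergy hK hh hφ) EReal.coe_ennreal_strictMono.monotone
    · exact (continuous_coe_real_ereal.comp_continuousOn hq.neg).lowerSemicontinuousOn
  have hGE : ∀ μ ∈ E, G μ = (weightedEnergy κ A f μ : EReal) := by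
    intro μ hμ
    obtain ⟨h1, h2⟩ := weightedEnergy_eq hK hh hh' hφ' hms (hED hμ) hμ
    change (shiftedEnergy h φ μ : EReal) + ((-q μ : ℝ) : EReal) = _
    rw [← EReal.coe_ennreal_toReal h1.ne, h2, ← EReal.coe_add]
    exact congrArg _ (add_neg_cancel_right _ (q μ))
  have hGD : ∀ μ ∈ D, μ ∉ E → G μ = ⊤ := by
    intro μ hμ hμE
    have : shiftedEnergy h φ μ = ∞ := by
      by_contra hcon
      exact hμE (mem_admissible_of_shiftedEnergy_lt_top hκ hA' hK hKA' hh hφ hh' hφ' hms hμ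
        (Ne.lt_top hcon))
    change (shiftedEnergy h φ μ : EReal) + ((-q μ : ℝ) : EReal) = ⊤
    rw [this, EReal.coe_ennreal_top, EReal.top_add_coe]
  have hD : IsCompact D := isCompact_carriedClass hK hgcont
  obtain ⟨h1, h2, h3⟩ := minimizers_of_lowerSemicontinuousOn.{w} hD hD.isClosed hED hne hG
    (fun μ hμ => hGE μ hμ ▸ EReal.coe_ne_top _) hGD
  have hmin : ⨅ ν ∈ E, G ν = minimalValue κ A f a g I₀ ξ := biInf_congr hGE
  have hsol : {μ | μ ∈ E ∧ G μ = ⨅ ν ∈ E, G ν} = solutions κ A f a g I₀ ξ := by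
    ext μ
    refine and_congr_right fun hμ => ?_
    rw [hGE μ hμ, hmin]
  rw [hmin] at h3
  rw [hsol] at h1 h2
  refine ⟨h1, h2, Subset.antisymm (fun l hl => ?_) ?_⟩
  · -- A solution is the limit of a constant net.
    refine ⟨PUnit, inferInstance, inferInstance, inferInstance, fun _ => l,
      ⟨fun _ => hl.1, ?_⟩, ?_⟩
    · rw [hl.2]
      exact tendsto_const_nhds
    · exact tendsto_const_nhds.mapClusterPt
  · rintro l ⟨S, _, _, _, μ, hμ, hl⟩
    rw [← hsol, hmin]
    refine h3 μ hμ.mem (hμ.tendsto.congr fun s => (hGE _ (hμ.mem s)).symm) l hl
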